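/- Let $(E,\mathcal E)$ be a measurable space whose $\sigma$-algebra $\mathcal E$ is countably generated, and let $Q$ be a bounded positive kernel on $(E,\mathcal E)$: $Q(\cdot,A)$ is measurable for every $A\in\mathcal E$, $Q(x,\cdot)$ is a positive measure for every $x\in E$, and $\sup_{x\in E}Q(x,E)<+\infty$. Let $\mathcal B$ be the Banach space of bounded measurable complex-valued functions on $E$ with the supremum norm. The kernel $Q$ acts on $\mathcal B$ by $Qf(x)=\int_E f(y)\,Q(x,dy)$, and $Q^\ell$ denotes the $\ell$-th iterate of the kernel $Q$. For a bounded measurable function $\chi:E\times E\to\mathbb C$ put $\|\chi\|=\sup_{E\times E}|\chi|$ and let $Q_\chi$ be the bounded operator on $\mathcal B$ given by $Q_\chi f(x)=\int_E f(y)\chi(x,y)\,Q(x,dy)$. For a bounded operator $T$ on $\mathcal B$ let $r(T)$ be its spectral radius. Its essential spectral radius $r_e(T)$ is the infimum of $r(T)$ and of the real numbers $\rho\ge 0$ for which $\mathcal B=F\oplus H$ with $T$-invariant subspaces $F,H$ such that $H$ is closed, $r(T|_H)<\rho$, $\dim F<+\infty$, and all eigenvalues of $T|_F$ have modulus $\ge\rho$.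 The operator $T$ is called quasi-compact if $r_e(T)<r(T)$. For a probability measure $\nu$ on $(E,\mathcal E)$ and a bounded positive kernel $R$ put $$\Delta_\nu(R)=\limsup_{A\in\mathcal E,\ \nu(A)\to 0}\Big(\sup_{x\in E}R(x,A)\Big)=\inf_{\eta>0}\ \sup_{A\in\mathcal E,\ \nu(A)\le\eta}\ \sup_{x\in E}R(x,A).$$ Suppose that there are an integer $\ell\ge 1$ and a probability measure $\nu$ on $(E,\mathcal E)$ with $\Delta_\nu(Q^\ell)^{1/\ell}<r(Q)$. Then: (i) $Q$ is quasi-compact and $r_e(Q)\le\Delta_\nu(Q^\ell)^{1/\ell}$; (ii) for every bounded measurable $\chi:E\times E\to\mathbb C$ with $\|\chi\|\,\Delta_\nu(Q^\ell)^{1/\ell}<r(Q_\chi)$, the operator $Q_\chi$ is quasi-compact and $r_e(Q_\chi)\le\|\chi\|\,\Delta_\nu(Q^\ell)^{1/\ell}$. -/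

import Mathlib

open MeasureTheory ProbabilityTheory Filter Topology
open scoped ENNReal NNReal

namespace PositiveKernel

/-! ### The essential spectral radius of a bounded operator -/

section Operator

variable {V : Type*} [NormedAddCommGroup V] [NormedSpace ℂ V]

/-- `V = F ⊕ H` with `F`, `H` invariant under `T`, `F` finite dimensional, `H` closed, the spectral
radius of `T` on `H` smaller than `ρ` and all eigenvalues of `T` on `F` of modulus at least `ρ`. -/
def HasSpectralSplitting (T : V →L[ℂ] V) (ρ : ℝ≥0) : Prop :=
  ∃ (F H : Submodule ℂ V) (hF : ∀ f ∈ F, T f ∈ F) (hH : ∀ h ∈ H, T h ∈ H),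
    IsCompl F H ∧ IsClosed (H : Set V) ∧ spectralRadius ℂ (T.restrict hH) < (ρ : ℝ≥0∞) ∧
    FiniteDimensional ℂ F ∧
    ∀ z : ℂ, Module.End.HasEigenvalue ((T : V →ₗ[ℂ] V).restrict hF) z → (ρ : ℝ) ≤ ‖z‖

/-- The essential spectral radius `r_e(T)`: the infimum of `r(T)` and of the real numbers `ρ ≥ 0`
at which `T` has a spectral splitting. -/
noncomputable def essentialSpectralRadius (T : V →L[ℂ] V) : ℝ≥0∞ :=
  sInf ({spectralRadius ℂ T} ∪ {r : ℝ≥0∞ | ∃ ρ : ℝ≥0, HasSpectralSplitting T ρ ∧ r = ρ})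

/-- `T` is quasi-compact if `r_e(T) < r(T)`. -/
def IsQuasiCompactOperator (T : V →L[ℂ] V) : Prop :=
  essentialSpectralRadius T < spectralRadius ℂ T

end Operator

/-! ### Bounded measurable functions and the action of a kernel -/

section Kernels

/-- The bounded measurable complex valued functions on `X`, as a subspace of the space `ℓ^∞(X)` of
all bounded functions with the supremum norm. -/
def boundedMeasurableSubmodule (X : Type*) [MeasurableSpace X] :
    Submodule ℂ (lp (fun _ : X => ℂ) ∞) where
  carrier := {f | Measurable (f : X → ℂ)}
  add_mem' := fun {_ _} hf hg => Measurable.add hf hg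
  zero_mem' := measurable_const (a := (0 : ℂ))
  smul_mem' := fun c _ hf => Measurable.const_smul hf c

/-- The normed space of bounded measurable complex valued functions on `X`, with the supremum
norm. -/
abbrev BoundedMeasurable (X : Type*) [MeasurableSpace X] : Type _ :=
  boundedMeasurableSubmodule X

variable {E : Type*} [MeasurableSpace E]

/-- The value at `x` of a bounded measurable function. -/
abbrev BoundedMeasurable.eval (f : BoundedMeasurable E) (x : E) : ℂ :=
  (f : lp (fun _ : E => ℂ) ∞) x

theorem BoundedMeasurable.measurable_eval (f : BoundedMeasurable E) : Measurable f.eval := f.2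

theorem BoundedMeasurable.norm_eval_le (f : BoundedMeasurable E) (x : E) : ‖f.eval x‖ ≤ ‖f‖ :=
  lp.norm_apply_le_norm ENNReal.top_ne_zero _ x

theorem BoundedMeasurable.norm_le (f : BoundedMeasurable E) {C : ℝ} (hC : 0 ≤ C)
    (h : ∀ x, ‖f.eval x‖ ≤ C) : ‖f‖ ≤ C :=
  lp.norm_le_of_forall_le hC h

/-- A bounded measurable function, as an element of `BoundedMeasurable E`. -/
def BoundedMeasurable.mk (f : E → ℂ) (hf : Measurable f) (C : ℝ) (hC : ∀ x, ‖f x‖ ≤ C) :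
    BoundedMeasurable E :=
  ⟨⟨f, memℓp_infty ⟨C, by rintro _ ⟨x, rfl⟩; exact hC x⟩⟩, hf⟩

theorem integrable_eval_mul (Q : Kernel E E) [IsFiniteKernel Q] (χ : BoundedMeasurable (E × E))
    (f : BoundedMeasurable E) (x : E) : Integrable (fun y => f.eval y * χ.eval (x, y)) (Q x) := by
  refine Integrable.of_bound (C := ‖f‖ * ‖χ‖)
    (f.measurable_eval.mul (χ.measurable_eval.comp measurable_prodMk_left)).aestronglyMeasurable
    (Eventually.of_forall fun y => ?_)
  rw [norm_mul]
  exact mul_le_mul (f.norm_eval_le y) (χ.norm_eval_le _) (norm_nonneg _) (norm_nonneg _)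

theorem norm_integral_eval_mul_le (Q : Kernel E E) [IsFiniteKernel Q]
    (χ : BoundedMeasurable (E × E)) (f : BoundedMeasurable E) (x : E) :
    ‖∫ y, f.eval y * χ.eval (x, y) ∂Q x‖ ≤ ‖χ‖ * Q.bound.toReal * ‖f‖ := by
  have h := norm_integral_le_of_norm_le_const (μ := Q x) (C := ‖f‖ * ‖χ‖)
    (f := fun y => f.eval y * χ.eval (x, y)) (Eventually.of_forall fun y => by
      rw [norm_mul]
      exact mul_le_mul (f.norm_eval_le y) (χ.norm_eval_le _) (norm_nonneg _) (norm_nonneg _))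
  have hb : (Q x).real Set.univ ≤ Q.bound.toReal :=
    ENNReal.toReal_mono Q.bound_ne_top (Kernel.measure_le_bound Q x _)
  calc _ ≤ ‖f‖ * ‖χ‖ * (Q x).real Set.univ := h
    _ ≤ ‖f‖ * ‖χ‖ * Q.bound.toReal := by gcongr
    _ = _ := by ring

/-- The operator `Q_χ` on bounded measurable functions,
`Q_χ f (x) = ∫ f(y) χ(x, y) Q(x, dy)`. -/
noncomputable def twistedOp (Q : Kernel E E) [IsFiniteKernel Q] (χ : BoundedMeasurable (E × E)) :
    BoundedMeasurable E →L[ℂ] BoundedMeasurable E :=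
  LinearMap.mkContinuous
    { toFun := fun f => BoundedMeasurable.mk (fun x => ∫ y, f.eval y * χ.eval (x, y) ∂Q x)
        (StronglyMeasurable.integral_kernel_prod_right (κ := Q)
          (f := fun x y => f.eval y * χ.eval (x, y))
          ((f.measurable_eval.comp measurable_snd).mul χ.measurable_eval).stronglyMeasurable
          ).measurable
        _ (norm_integral_eval_mul_le Q χ f)
      map_add' := fun f g => by
        ext x
        change ∫ y, (f.eval y + g.eval y) * χ.eval (x, y) ∂Q x =
          ∫ y, f.eval y * χ.eval (x, y) ∂Q x + ∫ y, g.eval y * χ.eval (x, y) ∂Q x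
        simp_rw [add_mul]
        exact integral_add (integrable_eval_mul Q χ f x) (integrable_eval_mul Q χ g x)
      map_smul' := fun c f => by
        ext x
        change ∫ y, c * f.eval y * χ.eval (x, y) ∂Q x = c * ∫ y, f.eval y * χ.eval (x, y) ∂Q x
        simp_rw [mul_assoc]
        exact integral_const_mul c _ }
    (‖χ‖ * Q.bound.toReal)
    fun f => BoundedMeasurable.norm_le _ (by positivity) (norm_integral_eval_mul_le Q χ f)

theorem integrable_eval (Q : Kernel E E) [IsFiniteKernel Q]
    (f : BoundedMeasurable E) (x : E) : Integrable (fun y => f.eval y) (Q x) :=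
  Integrable.of_bound (C := ‖f‖) f.measurable_eval.aestronglyMeasurable
    (Eventually.of_forall f.norm_eval_le)

theorem norm_integral_eval_le (Q : Kernel E E) [IsFiniteKernel Q]
    (f : BoundedMeasurable E) (x : E) : ‖∫ y, f.eval y ∂Q x‖ ≤ Q.bound.toReal * ‖f‖ := by
  have h := norm_integral_le_of_norm_le_const (μ := Q x) (C := ‖f‖)
    (f := fun y => f.eval y) (Eventually.of_forall f.norm_eval_le)
  have hb : (Q x).real Set.univ ≤ Q.bound.toReal :=
    ENNReal.toReal_mono Q.bound_ne_top (Kernel.measure_le_bound Q x _)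
  calc _ ≤ ‖f‖ * (Q x).real Set.univ := h
    _ ≤ ‖f‖ * Q.bound.toReal := by gcongr
    _ = _ := by ring

/-- The operator on bounded measurable functions defined by a bounded positive kernel `Q`,
`Q f (x) = ∫ f(y) Q(x, dy)`. -/
noncomputable def kernelOp (Q : Kernel E E) [IsFiniteKernel Q] :
    BoundedMeasurable E →L[ℂ] BoundedMeasurable E :=
  LinearMap.mkContinuous
    { toFun := fun f => BoundedMeasurable.mk (fun x => ∫ y, f.eval y ∂Q x)
        (StronglyMeasurable.integral_kernel_prod_right (κ := Q) (f := fun _ y => f.eval y)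
          (f.measurable_eval.comp measurable_snd).stronglyMeasurable).measurable
        _ (norm_integral_eval_le Q f)
      map_add' := fun f g => by
        ext x
        exact integral_add (integrable_eval Q f x) (integrable_eval Q g x)
      map_smul' := fun c f => by
        ext x
        exact integral_const_mul c _ }
    Q.bound.toReal
    fun f => BoundedMeasurable.norm_le _ (by positivity) (norm_integral_eval_le Q f)

theorem kernelOp_apply (Q : Kernel E E) [IsFiniteKernel Q] (f : BoundedMeasurable E) (x : E) :
    (kernelOp Q f).eval x = ∫ y, f.eval y ∂Q x := rfl

theorem twistedOp_apply (Q : Kernel E E) [IsFiniteKernel Q] (χ : BoundedMeasurable (E × E))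
    (f : BoundedMeasurable E) (x : E) :
    (twistedOp Q χ f).eval x = ∫ y, f.eval y * χ.eval (x, y) ∂Q x := rfl

/-- `Δ_ν(Q) = limsup_{ν(A) → 0} sup_x Q(x, A)`, the upper limit being over measurable sets `A`
(those with `ν(A) = 0` included). -/
noncomputable def doeblinDelta (ν : Measure E) (Q : Kernel E E) : ℝ≥0∞ :=
  limsup (fun A : {A : Set E // MeasurableSet A} => ⨆ x, Q x A)
    (comap (fun A : {A : Set E // MeasurableSet A} => ν A) (𝓝 0))

end Kernels

end PositiveKernel

/-! Write `T` for `Q_χ`. A power `T ^ ℓ` is again a weighted operator, over the kernel `Q ^ ℓ`, with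
a weight bounded by `‖χ‖ ^ ℓ`: the product of the weights is averaged over the intermediate
positions (`exists_twistedOp_mul`). The Lebesgue decomposition of `Q ^ ℓ` with respect to `ν`, with
truncated density, gives `T ^ ℓ = K + R`, where `K` has a bounded density with respect to `ν` and
`‖R‖ ≤ ‖χ‖ ^ ℓ * d`, for any prescribed `d` above `Δ_ν(Q ^ ℓ)` (`exists_twistedOp_eq_add`).

No approximation of `K` itself by finite-rank operators is claimed, but `K R^j K` is always a norm
limit of such. Indeed `K R^j` is dominated by a finite measure `μ`, so `K R^j K` depends on the
density of its last factor continuously for the `L¹(μ ⊗ ν)` norm, in which combinations of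
rectangles are dense (`IsDominatedBy.mul_twistedOp_const_mem`). Hence every word with two or more
letters `K` in the expansion of `(K + R)^m` is negligible. The other words have total norm of order
`m e^m`, where `e` bounds `‖R‖`. If `e < ρ ^ ℓ`, some power `T ^ n` is therefore `S + G` with `G` of
finite rank and `4 ‖S‖ ≤ ρ ^ n`.

The splitting at `ρ` comes from Riesz theory for `A = T ^ n`, without functional calculus. If all
roots of `p` have modulus at least `ρ ^ n`, then `p(A)` is invertible plus finite rank, hence of
index zero. The kernels of these `p(A)` stabilise, and the stable kernel and the corresponding range
are `F` and `H` (`hasSpectralSplitting_of_pow_eq_add`). Letting `ρ` decrease bounds `r_e(T)`; part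
(i) is the weight `1`. -/

/-! ### Index zero for the identity plus a finite-rank map. -/

section IndexZero

variable {K V : Type*} [Field K] [AddCommGroup V] [Module K V]

theorem LinearMap.ker_one_add_le_range (G : V →ₗ[K] V) : LinearMap.ker (1 + G) ≤ G.range := by
  intro x hx
  have h : x + G x = 0 := by simpa using hx
  exact ⟨-x, by rw [map_neg]; exact (eq_neg_of_add_eq_zero_left h).symm⟩

/-- The range of `1 + G` has a finite codimension, equal to the dimension of its kernel, when `G`
has finite rank. -/
theorem LinearMap.finrank_ker_one_add (G : V →ₗ[K] V) (hG : G.HasFiniteRange) :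
    FiniteDimensional K (LinearMap.ker (1 + G)) ∧
      FiniteDimensional K (V ⧸ LinearMap.range (1 + G)) ∧
      Module.finrank K (LinearMap.ker (1 + G)) =
        Module.finrank K (V ⧸ LinearMap.range (1 + G)) := by
  set W := G.range with hW
  have : FiniteDimensional K W := Module.Finite.of_fg hG
  have hker := G.ker_one_add_le_range
  have hmaps : ∀ x ∈ W, (1 + G) x ∈ W := fun x hx => W.add_mem hx ⟨x, rfl⟩
  -- Everything is counted inside the finite-dimensional `W`. The kernel of `1 + G` lies in `W`, so
  -- it is the kernel of `B`; and `v ≡ -G v` modulo the range of `1 + G`, so the cokernel is `W ⧸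
  -- B.range`. Rank-nullity for `B` concludes.
  set B : W →ₗ[K] W := (1 + G).restrict hmaps with hB
  let φ : W →ₗ[K] V ⧸ LinearMap.range (1 + G) := (Submodule.mkQ _) ∘ₗ W.subtype
  have hφ : Function.Surjective φ := by
    intro q
    obtain ⟨v, rfl⟩ := Submodule.mkQ_surjective _ q
    refine ⟨-⟨G v, v, rfl⟩, ?_⟩
    simp only [φ, LinearMap.comp_apply, Submodule.mkQ_apply]
    rw [Submodule.Quotient.eq]
    exact ⟨-v, by simp; abel⟩
  have hφker : LinearMap.ker φ = B.range := by
    ext w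
    simp only [φ, LinearMap.mem_ker, LinearMap.comp_apply, Submodule.mkQ_apply,
      Submodule.Quotient.mk_eq_zero]
    constructor
    · rintro ⟨v, hv⟩
      have hv' : v + G v = w := hv
      have hvW : v ∈ W := by
        rw [eq_sub_of_add_eq hv']
        exact W.sub_mem w.2 ⟨v, rfl⟩
      exact ⟨⟨v, hvW⟩, Subtype.ext hv⟩
    · rintro ⟨v, rfl⟩
      exact ⟨v, rfl⟩
  have hkerB : LinearMap.ker B = (LinearMap.ker (1 + G)).comap W.subtype := by
    ext w
    simp [hB, Subtype.ext_iff, LinearMap.restrict_apply]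
  have e1 := (φ.quotKerEquivOfSurjective hφ).finrank_eq
  have e2 : Module.finrank K B.ker = Module.finrank K (LinearMap.ker (1 + G)) := by
    rw [hkerB]
    exact (Submodule.comapSubtypeEquivOfLe hker).finrank_eq
  have e3 := B.finrank_range_add_finrank_ker
  have e4 := Submodule.finrank_quotient_add_finrank (LinearMap.ker φ)
  rw [hφker] at e4
  have e5 : Module.finrank K (W ⧸ LinearMap.ker φ) = Module.finrank K (W ⧸ B.range) := by
    rw [hφker]
  refine ⟨Submodule.finiteDimensional_of_le hker, Module.Finite.of_surjective φ hφ, ?_⟩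
  omega

end IndexZero

/-! ### Bounded operators that are invertible plus finite rank. -/

section FredholmIndexZero

variable {V : Type*} [NormedAddCommGroup V] [NormedSpace ℂ V]

/-- The operators that differ from an invertible one by an operator of finite rank. -/
def IsUnitAddFiniteRank (L : V →L[ℂ] V) : Prop :=
  ∃ U G : V →L[ℂ] V, IsUnit U ∧ (G : V →ₗ[ℂ] V).HasFiniteRange ∧ L = U + G

theorem IsUnit.isUnitAddFiniteRank {U : V →L[ℂ] V} (hU : IsUnit U) : IsUnitAddFiniteRank U :=
  ⟨U, 0, hU, by simp, by simp⟩

theorem IsUnitAddFiniteRank.mul {L L' : V →L[ℂ] V} (h : IsUnitAddFiniteRank L)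
    (h' : IsUnitAddFiniteRank L') : IsUnitAddFiniteRank (L * L') := by
  obtain ⟨U, G, hU, hG, rfl⟩ := h
  obtain ⟨U', G', hU', hG', rfl⟩ := h'
  refine ⟨U * U', U * G' + G * (U' + G'), hU.mul hU', ?_, by noncomm_ring⟩
  exact (hG'.comp_left (U : V →ₗ[ℂ] V)).add (hG.comp_right ((U' + G' : V →L[ℂ] V) : V →ₗ[ℂ] V))

theorem IsUnitAddFiniteRank.finrank_ker {L : V →L[ℂ] V} (h : IsUnitAddFiniteRank L) :
    FiniteDimensional ℂ (LinearMap.ker (L : V →ₗ[ℂ] V)) ∧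
      FiniteDimensional ℂ (V ⧸ LinearMap.range (L : V →ₗ[ℂ] V)) ∧
      Module.finrank ℂ (LinearMap.ker (L : V →ₗ[ℂ] V)) =
        Module.finrank ℂ (V ⧸ LinearMap.range (L : V →ₗ[ℂ] V)) := by
  obtain ⟨_, G, ⟨u, rfl⟩, hG, rfl⟩ := h
  set e : V ≃L[ℂ] V := ContinuousLinearEquiv.ofUnit u
  have he : ((u : V →L[ℂ] V) : V →ₗ[ℂ] V) = (e.toLinearEquiv : V →ₗ[ℂ] V) := rfl
  set G' : V →ₗ[ℂ] V := (e.symm.toLinearEquiv : V →ₗ[ℂ] V) ∘ₗ (G : V →ₗ[ℂ] V)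
  have hG' : G'.HasFiniteRange := hG.comp_left _
  -- Factoring out the invertible part, `u + G = u (1 + u⁻¹ G)`, reduces to the previous case.
  have hL : (((u : V →L[ℂ] V) + G : V →L[ℂ] V) : V →ₗ[ℂ] V) =
      (e.toLinearEquiv : V →ₗ[ℂ] V) ∘ₗ (1 + G') := by
    ext x
    change u.val x + G x = e (x + e.symm (G x))
    rw [map_add, e.apply_symm_apply]
    rfl
  obtain ⟨h1, h2, h3⟩ := G'.finrank_ker_one_add hG'
  have hk : LinearMap.ker (((u : V →L[ℂ] V) + G : V →L[ℂ] V) : V →ₗ[ℂ] V) =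
      LinearMap.ker (1 + G') := by
    rw [hL, LinearMap.ker_comp, LinearEquiv.ker, Submodule.comap_bot]
  have hr : LinearMap.range (((u : V →L[ℂ] V) + G : V →L[ℂ] V) : V →ₗ[ℂ] V) =
      (LinearMap.range (1 + G')).map (e.toLinearEquiv : V →ₗ[ℂ] V) := by
    rw [hL, LinearMap.range_comp]
  let q : (V ⧸ LinearMap.range (1 + G')) ≃ₗ[ℂ]
      V ⧸ LinearMap.range (((u : V →L[ℂ] V) + G : V →L[ℂ] V) : V →ₗ[ℂ] V) :=
    Submodule.Quotient.equiv _ _ e.toLinearEquiv hr.symm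
  rw [hk]
  exact ⟨h1, Module.Finite.equiv q, h3.trans q.finrank_eq⟩

open LinearMap.FiniteRangeSetoid in
theorem IsUnitAddFiniteRank.isClosed_range {L : V →L[ℂ] V}
    (h : IsUnitAddFiniteRank L) : IsClosed (LinearMap.range (L : V →ₗ[ℂ] V) : Set V) := by
  obtain ⟨_, G, ⟨u, rfl⟩, hG, rfl⟩ := h
  set e : V ≃L[ℂ] V := ContinuousLinearEquiv.ofUnit u
  refine ((ContinuousLinearMap.isStrictMap_isClosed_range_iff_of_finiteRangeSetoid
    ((u : V →L[ℂ] V) + G) (u : V →L[ℂ] V) ?_).2 ⟨?_, ?_⟩).2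
  · rw [LinearMap.FiniteRangeSetoid.equiv_iff_hasFiniteRange]
    simpa using hG
  · exact e.toHomeomorph.isHomeomorph.isEmbedding.isStrictMap
  · have : LinearMap.range ((u : V →L[ℂ] V) : V →ₗ[ℂ] V) = ⊤ :=
      LinearMap.range_eq_top.2 e.surjective
    simp [this]

/-- An operator of index zero whose kernel meets its range trivially splits the space. -/
theorem IsUnitAddFiniteRank.isCompl {L : V →L[ℂ] V} (h : IsUnitAddFiniteRank L)
    (hd : Disjoint (LinearMap.ker (L : V →ₗ[ℂ] V)) (LinearMap.range (L : V →ₗ[ℂ] V))) :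
    IsCompl (LinearMap.ker (L : V →ₗ[ℂ] V)) (LinearMap.range (L : V →ₗ[ℂ] V)) := by
  obtain ⟨h1, h2, h3⟩ := h.finrank_ker
  set F := LinearMap.ker (L : V →ₗ[ℂ] V)
  set H := LinearMap.range (L : V →ₗ[ℂ] V)
  refine ⟨hd, ?_⟩
  let φ : F →ₗ[ℂ] V ⧸ H := H.mkQ ∘ₗ F.subtype
  have hinj : Function.Injective φ := by
    rw [← LinearMap.ker_eq_bot, LinearMap.ker_comp, Submodule.ker_mkQ]
    exact Submodule.disjoint_iff_comap_eq_bot.1 hd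
  have hsurj : Function.Surjective φ := 
    (LinearMap.injective_iff_surjective_of_finrank_eq_finrank h3).1 hinj
  rw [codisjoint_iff, eq_top_iff]
  intro v _
  obtain ⟨f, hf⟩ := hsurj (H.mkQ v)
  have : v - f ∈ H := by
    rw [← Submodule.Quotient.eq]
    exact hf.symm
  rw [← add_sub_cancel (f : V) v]
  exact Submodule.add_mem_sup f.2 this

/-- Nested ranges of operators of index zero with equal kernels are equal. -/
theorem IsUnitAddFiniteRank.range_eq {L L' : V →L[ℂ] V} (h : IsUnitAddFiniteRank L)
    (h' : IsUnitAddFiniteRank L')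
    (hk : LinearMap.ker (L' : V →ₗ[ℂ] V) = LinearMap.ker (L : V →ₗ[ℂ] V))
    (hr : LinearMap.range (L' : V →ₗ[ℂ] V) ≤ LinearMap.range (L : V →ₗ[ℂ] V)) :
    LinearMap.range (L' : V →ₗ[ℂ] V) = LinearMap.range (L : V →ₗ[ℂ] V) := by
  obtain ⟨h1, h2, h3⟩ := h.finrank_ker
  obtain ⟨h1', h2', h3'⟩ := h'.finrank_ker
  rw [hk] at h3'
  have hinj : Function.Injective (Submodule.factor hr) :=
    (LinearMap.injective_iff_surjective_of_finrank_eq_finrank (h3'.symm.trans h3)).2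
      (Submodule.factor_surjective hr)
  refine le_antisymm hr fun v hv => ?_
  rw [← Submodule.Quotient.mk_eq_zero]
  apply hinj
  rw [map_zero]
  exact (Submodule.Quotient.mk_eq_zero _).2 hv

end FredholmIndexZero

/-! ### Riesz theory: from `T ^ n = S + G` to a spectral splitting. -/

section SpectralSplitting

open Polynomial

variable {V : Type*} [NormedAddCommGroup V] [NormedSpace ℂ V]

/-- The products of linear polynomials whose roots have modulus at least `a`. -/
noncomputable def largeRootPolynomials (a : ℝ) : Submonoid ℂ[X] :=
  Submonoid.closure {p | ∃ z : ℂ, a ≤ ‖z‖ ∧ p = X - C z}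

theorem X_sub_C_mem_largeRootPolynomials {a : ℝ} {z : ℂ} (hz : a ≤ ‖z‖) :
    X - C z ∈ largeRootPolynomials a :=
  Submonoid.subset_closure ⟨z, hz, rfl⟩

theorem le_norm_of_eval_eq_zero {a : ℝ} {p : ℂ[X]} (hp : p ∈ largeRootPolynomials a) {w : ℂ}
    (hw : p.eval w = 0) : a ≤ ‖w‖ := by
  induction hp using Submonoid.closure_induction with
  | mem p h =>
    obtain ⟨z, hz, rfl⟩ := h
    have : w = z := by simpa [sub_eq_zero] using hw
    rwa [this]
  | one => simp at hw
  | mul p q _ _ hp hq =>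
    rw [eval_mul, mul_eq_zero] at hw
    exact hw.elim hp hq

theorem aeval_X_sub_C_apply (A : V →L[ℂ] V) (z : ℂ) (x : V) :
    aeval A (X - C z) x = A x - z • x := by
  simp [Algebra.algebraMap_eq_smul_one]

theorem aeval_mul_apply (A : V →L[ℂ] V) (p q : ℂ[X]) (x : V) :
    aeval A (p * q) x = aeval A p (aeval A q x) := by
  rw [map_mul]; rfl

theorem aeval_apply_comm {A B : V →L[ℂ] V} (h : Commute B A) (p : ℂ[X]) (x : V) :
    aeval A p (B x) = B (aeval A p x) := by
  have : Commute B (aeval A p) := by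
    induction p using Polynomial.induction_on' with
    | add p q hp hq => rw [map_add]; exact hp.add_right hq
    | monomial n c =>
      rw [aeval_monomial]
      exact (Algebra.commute_algebraMap_right c B).mul_right (h.pow_right n)
  exact DFunLike.congr_fun this.symm x

theorem aeval_pow_apply_of_apply_eq_smul {T : V →L[ℂ] V} {w : ℂ} {f : V} (hTf : T f = w • f)
    (n : ℕ) (q : ℂ[X]) : aeval (T ^ n) q f = q.eval (w ^ n) • f := by
  have hTn : ∀ m : ℕ, (T ^ m) f = w ^ m • f := by
    intro m
    induction m with
    | zero => simp
    | succ m ih =>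
      rw [pow_succ, pow_succ, mul_apply_eq_comp, hTf, map_smul, ih, smul_smul,
        mul_comm]
  induction q using Polynomial.induction_on' with
  | add p q hp hq => simp [hp, hq, add_smul]
  | monomial m c =>
    simp [aeval_monomial, ← pow_mul, hTn, Algebra.algebraMap_eq_smul_one, smul_smul]

theorem exists_mem_apply_eq_smul_of_hasEigenvalue_restrict {V : Type*} [AddCommGroup V]
    [Module ℂ V] {T : V →ₗ[ℂ] V} {F : Submodule ℂ V} (hF : ∀ f ∈ F, T f ∈ F) {w : ℂ}
    (hw : Module.End.HasEigenvalue (T.restrict hF) w) :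
    ∃ f ∈ F, f ≠ 0 ∧ T f = w • f := by
  obtain ⟨f, hf⟩ := hw.exists_hasEigenvector
  exact ⟨f, f.2, fun h => hf.2 (Subtype.ext h), congrArg Subtype.val hf.apply_eq_smul⟩

/-- The spectral radius is attained when the spectrum is nonempty. The empty case occurs when the
space is zero and is where `0 < ρ` is needed. -/
theorem spectralRadius_lt_of_forall_nnnorm_lt [CompleteSpace V] {B : V →L[ℂ] V} {ρ : ℝ≥0}
    (hρ : 0 < ρ) (h : ∀ w ∈ spectrum ℂ B, ‖w‖₊ < ρ) : spectralRadius ℂ B < ρ := by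
  rcases (spectrum ℂ B).eq_empty_or_nonempty with he | hne
  · simp only [spectralRadius, he]
    simpa using hρ
  · exact spectrum.spectralRadius_lt_of_forall_lt_of_nonempty hne h

/-- Each factor is `A - z = (S - z) + G`, with `S - z` invertible because `‖S‖ < a ≤ ‖z‖`, and the
class is closed under products. -/
theorem isUnitAddFiniteRank_aeval [CompleteSpace V] {A S G : V →L[ℂ] V} (hA : A = S + G)
    (hG : (G : V →ₗ[ℂ] V).HasFiniteRange) {a : ℝ} (hS : ‖S‖ < a) {p : ℂ[X]}
    (hp : p ∈ largeRootPolynomials a) : IsUnitAddFiniteRank (aeval A p) := by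
  induction hp using Submonoid.closure_induction with
  | mem p h =>
    obtain ⟨z, hz, rfl⟩ := h
    refine ⟨-(algebraMap ℂ _ z - S), G, IsUnit.neg ?_, hG, ?_⟩
    · have hz0 : z ≠ 0 := by
        rintro rfl
        rw [norm_zero] at hz
        linarith [norm_nonneg S]
      by_contra hcon
      have := spectrum.norm_le_norm_mul_of_mem (𝕜 := ℂ) (a := S) (k := z) hcon
      have h1 := ContinuousLinearMap.norm_id_le (𝕜 := ℂ) (E := V)
      have h2 : ‖S‖ * ‖(1 : V →L[ℂ] V)‖ ≤ ‖S‖ * 1 := by gcongr; exact h1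
      linarith
    · rw [hA, map_sub, aeval_X, aeval_C]
      abel
  | one =>
    rw [map_one]
    exact isUnit_one.isUnitAddFiniteRank
  | mul p q _ _ hp hq =>
    rw [map_mul]
    exact hp.mul hq

/-- The kernels of the polynomials in `A` with large roots are stationary. -/
theorem exists_stationary_kernel {A S G : V →L[ℂ] V} (hA : A = S + G)
    (hG : (G : V →ₗ[ℂ] V).HasFiniteRange) {a : ℝ} (ha : 0 < a) (hS : 4 * ‖S‖ ≤ a) :
    ∃ p ∈ largeRootPolynomials a, ∀ z : ℂ, a ≤ ‖z‖ → ∀ x : V,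
      aeval A ((X - C z) * p) x = 0 → aeval A p x = 0 := by
  by_contra! hcon
  choose! z hz x hx hx0 using hcon
  -- If stationarity fails for every `p`, linear factors can be added forever. The kernels `W k` of
  -- `P k (A)` then form a strictly increasing chain of closed `A`-invariant subspaces, with `A - z
  -- (P k)` mapping `W (k + 1)` into `W k`.
  obtain ⟨P, hP0, hPs⟩ : ∃ P : ℕ → ℂ[X], P 0 = 1 ∧ ∀ k, P (k + 1) = (X - C (z (P k))) * P k :=
    ⟨fun k => Nat.rec 1 (fun _ q => (X - C (z q)) * q) k, rfl, fun _ => rfl⟩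
  have hP : ∀ k, P k ∈ largeRootPolynomials a := by
    intro k
    induction k with
    | zero => exact hP0 ▸ one_mem _
    | succ k ih =>
      rw [hPs]
      exact mul_mem (X_sub_C_mem_largeRootPolynomials (hz _ ih)) ih
  obtain ⟨W, hW⟩ : ∃ W : ℕ → Submodule ℂ V, ∀ k y, y ∈ W k ↔ aeval A (P k) y = 0 :=
    ⟨fun k => LinearMap.ker (aeval A (P k)).toLinearMap, fun _ _ => Iff.rfl⟩
  have hWc : ∀ k, IsClosed (W k : Set V) := by
    intro k
    have : (W k : Set V) = aeval A (P k) ⁻¹' {0} := Set.ext (hW k)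
    rw [this]
    exact isClosed_singleton.preimage (aeval A (P k)).continuous
  have hWs : ∀ k, W k ≤ W (k + 1) := by
    intro k y hy
    replace hy := (hW _ _).1 hy
    refine (hW _ _).2 ?_
    rw [hPs, aeval_mul_apply, hy, map_zero]
  have hWm : Monotone W := monotone_nat_of_le_succ hWs
  have hWA : ∀ k, ∀ y ∈ W k, A y ∈ W k := by
    intro k y hy
    replace hy := (hW _ _).1 hy
    refine (hW _ _).2 ?_
    rw [aeval_apply_comm (Commute.refl A), hy, map_zero]
  have hWd : ∀ k, ∀ y ∈ W (k + 1), A y - z (P k) • y ∈ W k := by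
    intro k y hy
    replace hy := (hW _ _).1 hy
    refine (hW _ _).2 ?_
    rwa [hPs, mul_comm, aeval_mul_apply, aeval_X_sub_C_apply] at hy
  have hy : ∀ k, ∃ y ∈ W (k + 1), ‖y‖ = 1 ∧ ∀ w ∈ W k, 3 / 4 ≤ ‖y - w‖ := by
    intro k
    obtain ⟨y, -, hy1, hy2⟩ := riesz_lemma_of_lt_one (𝕜 := ℂ) (E := W (k + 1))
      (F := (W k).comap (W (k + 1)).subtype) ((hWc k).preimage continuous_subtype_val)
      ⟨⟨x (P k), (hW _ _).2 (by rw [hPs]; exact hx _ (hP k))⟩,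
        fun h => hx0 _ (hP k) ((hW _ _).1 h)⟩ (r := 3 / 4) (by norm_num)
    exact ⟨y, y.2, hy1, fun w hw => hy2 ⟨w, hWs k hw⟩ hw⟩
  choose y hyW hy1 hyd using hy
  -- The Riesz vectors `y k` are unit vectors, so along a subsequence their images under `G` are
  -- Cauchy. For two late indices, `3a/4 ≤ ‖A (y k) - A (y j)‖ ≤ 2 ‖S‖ + ‖G (y k) - G (y j)‖ < a/2 +
  -- a/4`, a contradiction.
  have : FiniteDimensional ℂ (LinearMap.range (G : V →ₗ[ℂ] V)) := Module.Finite.of_fg hG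
  have : ProperSpace (LinearMap.range (G : V →ₗ[ℂ] V)) := FiniteDimensional.proper ℂ _
  obtain ⟨g, -, φ, hφ, hlim⟩ := tendsto_subseq_of_bounded
    (x := fun k => (⟨G (y k), y k, rfl⟩ : LinearMap.range (G : V →ₗ[ℂ] V)))
    (Metric.isBounded_closedBall (x := 0) (r := ‖G‖)) (fun k => by
      rw [mem_closedBall_zero_iff]
      exact (G.le_opNorm _).trans_eq (by rw [hy1, mul_one]))
  obtain ⟨N, hN⟩ := Metric.cauchySeq_iff.1 hlim.cauchySeq (a / 4) (by positivity)
  have hlt : φ N < φ (N + 1) := hφ (Nat.lt_succ_self N)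
  have hG' : ‖G (y (φ (N + 1))) - G (y (φ N))‖ < a / 4 := by
    rw [← dist_eq_norm]
    exact hN (N + 1) (Nat.le_succ N) N le_rfl
  set k := φ (N + 1)
  set j := φ N
  set c := z (P k)
  have hc : a ≤ ‖c‖ := hz _ (hP k)
  have hc0 : c ≠ 0 := norm_pos_iff.1 (ha.trans_le hc)
  have hyj : y j ∈ W k := hWm hlt (hyW j)
  have hmem : A (y j) - (A (y k) - c • y k) ∈ W k :=
    (W k).sub_mem (hWA k _ hyj) (hWd k _ (hyW k))
  have h1 : A (y k) - A (y j) = c • (y k - c⁻¹ • (A (y j) - (A (y k) - c • y k))) := by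
    rw [smul_sub, smul_inv_smul₀ hc0]
    abel
  have h2 : a * (3 / 4) ≤ ‖A (y k) - A (y j)‖ := by
    rw [h1, norm_smul]
    exact mul_le_mul hc (hyd k _ ((W k).smul_mem _ hmem)) (by norm_num) (norm_nonneg _)
  have h3 : ‖A (y k) - A (y j)‖ ≤ ‖S‖ * 2 + ‖G (y k) - G (y j)‖ := by
    have : A (y k) - A (y j) = S (y k - y j) + (G (y k) - G (y j)) := by
      rw [hA, map_sub, add_apply, add_apply]
      abel
    rw [this]
    refine (norm_add_le _ _).trans ?_
    gcongr
    refine (S.le_opNorm _).trans ?_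
    gcongr
    refine (norm_sub_le _ _).trans_eq ?_
    rw [hy1, hy1]
    norm_num
  linarith

/-- If a power of `T` is a finite rank perturbation of an operator of small norm, then `T` has a
spectral splitting. -/
theorem hasSpectralSplitting_of_pow_eq_add [CompleteSpace V] {T S G : V →L[ℂ] V} {n : ℕ}
    (hn : n ≠ 0) {ρ : ℝ≥0} (hρ : 0 < ρ) (hT : T ^ n = S + G)
    (hG : (G : V →ₗ[ℂ] V).HasFiniteRange) (hS : 4 * ‖S‖ ≤ (ρ : ℝ) ^ n) :
    PositiveKernel.HasSpectralSplitting T ρ := by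
  have ha : 0 < (ρ : ℝ) ^ n := by positivity
  have hS' : ‖S‖ < (ρ : ℝ) ^ n := by
    rcases (norm_nonneg S).eq_or_lt with h | h
    · rwa [← h]
    · linarith
  obtain ⟨p, hp, hstat⟩ := exists_stationary_kernel hT hG ha hS
  -- Stationarity passes from one linear factor to products. The case `q = p` says that `p(A)²` and
  -- `p(A)` have the same kernel, so kernel and range of `p(A)` meet trivially.
  have hstat' : ∀ q ∈ largeRootPolynomials ((ρ : ℝ) ^ n), ∀ x : V,
      aeval (T ^ n) (q * p) x = 0 → aeval (T ^ n) p x = 0 := by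
    intro q hq
    induction hq using Submonoid.closure_induction with
    | mem q h =>
      obtain ⟨z, hz, rfl⟩ := h
      exact hstat z hz
    | one => simp
    | mul q r _ _ hq hr =>
      intro x hx
      apply hr
      rw [mul_comm r p, aeval_mul_apply]
      apply hq
      rw [← aeval_mul_apply]
      rwa [mul_right_comm]
  set L := aeval (T ^ n) p with hL
  have hcomm : ∀ x, L (T x) = T (L x) := aeval_apply_comm (Commute.self_pow T n) p
  have hLu : IsUnitAddFiniteRank L := isUnitAddFiniteRank_aeval hT hG hS' hp
  have hF : ∀ f ∈ LinearMap.ker (L : V →ₗ[ℂ] V), T f ∈ LinearMap.ker (L : V →ₗ[ℂ] V) := by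
    intro f hf
    have hf' : L f = 0 := hf
    change L (T f) = 0
    rw [hcomm, hf', map_zero]
  have hH : ∀ h ∈ LinearMap.range (L : V →ₗ[ℂ] V), T h ∈ LinearMap.range (L : V →ₗ[ℂ] V) := by
    rintro _ ⟨v, rfl⟩
    exact ⟨T v, hcomm v⟩
  have hdisj : Disjoint (LinearMap.ker (L : V →ₗ[ℂ] V)) (LinearMap.range (L : V →ₗ[ℂ] V)) := by
    rw [Submodule.disjoint_def]
    rintro _ h ⟨v, rfl⟩
    refine hstat' p hp v ?_
    rw [aeval_mul_apply]
    exact h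
  have hclosed := hLu.isClosed_range
  refine ⟨LinearMap.ker (L : V →ₗ[ℂ] V), LinearMap.range (L : V →ₗ[ℂ] V), hF, hH,
    hLu.isCompl hdisj, hclosed, ?_, hLu.finrank_ker.1, ?_⟩
  · set H := LinearMap.range (L : V →ₗ[ℂ] V)
    have : CompleteSpace H := hclosed.completeSpace_coe
    have hpow : ∀ (m : ℕ) (h : H), (((T.restrict hH) ^ m) h : V) = (T ^ m) h := by
      intro m
      induction m with
      | zero => simp
      | succ m ih =>
        intro h
        rw [pow_succ, pow_succ]
        exact ih _
    have hspec : ∀ w ∈ spectrum ℂ (T.restrict hH), ‖w‖₊ < ρ := by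
      intro w hw
      by_contra! hle
      have hz : (ρ : ℝ) ^ n ≤ ‖w ^ n‖ := by
        rw [norm_pow]
        exact pow_le_pow_left₀ ρ.2 hle n
      -- It suffices that `T ^ n - w ^ n` is bijective on `H`. It is injective since its kernel
      -- there lies in `F ∩ H = 0`. It is surjective since `L` and `(T ^ n - w ^ n) L` have index
      -- zero and equal kernels, so their nested ranges coincide.
      refine spectrum.pow_mem_pow _ n hw ?_
      have hLu' := isUnitAddFiniteRank_aeval hT hG hS'
        (mul_mem (X_sub_C_mem_largeRootPolynomials hz) hp)
      have happ : ∀ x, aeval (T ^ n) ((X - C (w ^ n)) * p) x = (T ^ n) (L x) - w ^ n • L x :=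
        fun x => by rw [aeval_mul_apply, aeval_X_sub_C_apply]
      have hrange := hLu.range_eq hLu'
        (le_antisymm (fun x hx => hstat _ hz x hx) (fun x hx => by
          have hx' : L x = 0 := hx
          change aeval (T ^ n) ((X - C (w ^ n)) * p) x = 0
          rw [happ, hx', map_zero, smul_zero, sub_zero]))
        (by
          rintro _ ⟨v, rfl⟩
          refine ⟨aeval (T ^ n) (X - C (w ^ n)) v, ?_⟩
          change aeval (T ^ n) p _ = aeval (T ^ n) ((X - C (w ^ n)) * p) v
          rw [mul_comm, aeval_mul_apply])
      rw [spectrum.mem_resolventSet_iff, ContinuousLinearMap.isUnit_iff_bijective]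
      have hB : ∀ h : H, ((algebraMap ℂ (H →L[ℂ] H) (w ^ n) - T.restrict hH ^ n) h : V) =
          -((T ^ n) h - w ^ n • (h : V)) := by
        intro h
        rw [sub_apply, Submodule.coe_sub, hpow,
          Algebra.algebraMap_eq_smul_one]
        simp
      constructor
      · rw [injective_iff_map_eq_zero]
        rintro ⟨h, hh⟩ h0
        have h1 := hB ⟨h, hh⟩
        rw [h0, Submodule.coe_zero, zero_eq_neg] at h1
        refine Subtype.ext (Submodule.disjoint_def.1 hdisj h (hstat _ hz h ?_) hh)
        rw [mul_comm, aeval_mul_apply, aeval_X_sub_C_apply, h1, map_zero]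
      · rintro ⟨h, hh⟩
        obtain ⟨v, hv⟩ := hrange.ge hh
        refine ⟨-⟨L v, v, rfl⟩, Subtype.ext ?_⟩
        rw [map_neg, Submodule.coe_neg, hB, neg_neg, ← happ]
        exact hv
    exact spectralRadius_lt_of_forall_nnnorm_lt hρ hspec
  · intro w hw
    obtain ⟨f, hfF, hf0, hTf⟩ := exists_mem_apply_eq_smul_of_hasEigenvalue_restrict
      (T := (T : V →ₗ[ℂ] V)) (F := LinearMap.ker (L : V →ₗ[ℂ] V)) hF hw
    have h0 : p.eval (w ^ n) • f = 0 := by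
      rw [← aeval_pow_apply_of_apply_eq_smul hTf n p]
      exact hfF
    have := le_norm_of_eval_eq_zero hp ((smul_eq_zero.1 h0).resolve_right hf0)
    rw [norm_pow] at this
    exact (pow_le_pow_iff_left₀ ρ.2 (norm_nonneg w) hn).1 this

end SpectralSplitting

/-! ### Norm limits of finite-rank operators and the expansion of `(K + R) ^ n`. -/

section FiniteRankClosure

variable (V : Type*) [NormedAddCommGroup V] [NormedSpace ℂ V]

/-- The bounded operators of finite rank. -/
noncomputable def finiteRankOperators : Submodule ℂ (V →L[ℂ] V) where
  carrier := {G | (G : V →ₗ[ℂ] V).HasFiniteRange}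
  add_mem' hF hG := LinearMap.HasFiniteRange.add hF hG
  zero_mem' := LinearMap.HasFiniteRange.zero
  smul_mem' c _ hG := LinearMap.HasFiniteRange.smul hG c

/-- The norm limits of bounded operators of finite rank. -/
noncomputable def approximableOperators : Submodule ℂ (V →L[ℂ] V) :=
  (finiteRankOperators V).topologicalClosure

variable {V}

theorem mem_approximableOperators_of_hasFiniteRange {G : V →L[ℂ] V}
    (hG : (G : V →ₗ[ℂ] V).HasFiniteRange) : G ∈ approximableOperators V :=
  Submodule.le_topologicalClosure _ hG

theorem mul_mem_approximableOperators_left {A : V →L[ℂ] V} (hA : A ∈ approximableOperators V)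
    (B : V →L[ℂ] V) : B * A ∈ approximableOperators V :=
  map_mem_closure (f := fun G => B * G) (continuous_const.mul continuous_id) hA
    fun G hG => LinearMap.HasFiniteRange.comp_left (u := (G : V →ₗ[ℂ] V)) hG (B : V →ₗ[ℂ] V)

theorem mul_mem_approximableOperators_right {A : V →L[ℂ] V} (hA : A ∈ approximableOperators V)
    (B : V →L[ℂ] V) : A * B ∈ approximableOperators V :=
  map_mem_closure (f := fun G => G * B) (continuous_id.mul continuous_const) hA
    fun G hG => LinearMap.HasFiniteRange.comp_right (v := (G : V →ₗ[ℂ] V)) hG (B : V →ₗ[ℂ] V)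

theorem mem_approximableOperators_of_norm_sub_le {A : V →L[ℂ] V} {u : ℕ → V →L[ℂ] V} {b : ℕ → ℝ}
    (hu : ∀ n, u n ∈ approximableOperators V) (hb : ∀ n, ‖u n - A‖ ≤ b n)
    (hlim : Tendsto b atTop (𝓝 0)) : A ∈ approximableOperators V :=
  (Submodule.isClosed_topologicalClosure _).mem_of_tendsto
    (tendsto_iff_norm_sub_tendsto_zero.2 (squeeze_zero (fun _ => norm_nonneg _) hb hlim))
    (Eventually.of_forall hu)

/-- Modulo approximable operators, `(K + R) ^ n` is the sum of the terms of its expansion with at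
most one factor `K`. -/
theorem exists_add_pow_sub_mem_approximableOperators {K R : V →L[ℂ] V}
    (hK : ∀ j, K * R ^ j * K ∈ approximableOperators V) {d : ℝ} (hd : 0 ≤ d) (hR : ‖R‖ ≤ d)
    (n : ℕ) :
    ∃ B : V →L[ℂ] V, (K + R) ^ n - (R ^ n + B) ∈ approximableOperators V ∧
      (∀ m, B * R ^ m * K ∈ approximableOperators V) ∧ ‖B‖ * d ≤ n * ‖K‖ * d ^ n := by
  have hRn : ∀ n, ‖R ^ n‖ ≤ d ^ n := by
    intro n
    induction n with
    | zero => rw [pow_zero, pow_zero]; exact ContinuousLinearMap.norm_id_le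
    | succ n ih =>
      rw [pow_succ, pow_succ]
      exact (norm_mul_le _ _).trans (mul_le_mul ih hR (norm_nonneg _) (by positivity))
  induction n with
  | zero => exact ⟨0, by simp, by simp, by simp⟩
  | succ n ih =>
    obtain ⟨B, h1, h2, h3⟩ := ih
    -- This recursion builds `B = ∑ R^i K R^(n-1-i)`. The approximability of `B R^m K` is carried
    -- along to absorb the new words with two letters `K`. The norm bound is multiplied by `d` to
    -- avoid the exponent `n - 1`.
    refine ⟨B * R + R ^ n * K, ?_, fun m => ?_, ?_⟩
    · have : (K + R) ^ (n + 1) - (R ^ (n + 1) + (B * R + R ^ n * K)) =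
          ((K + R) ^ n - (R ^ n + B)) * (K + R) + B * R ^ 0 * K := by
        rw [pow_succ, pow_succ]
        noncomm_ring
      rw [this]
      exact add_mem (mul_mem_approximableOperators_right h1 _) (h2 0)
    · have : (B * R + R ^ n * K) * R ^ m * K = B * R ^ (m + 1) * K + R ^ n * (K * R ^ m * K) := by
        rw [pow_succ']
        noncomm_ring
      rw [this]
      exact add_mem (h2 _) (mul_mem_approximableOperators_left (hK m) _)
    · calc ‖B * R + R ^ n * K‖ * d ≤ (‖B‖ * d + d ^ n * ‖K‖) * d := by
            gcongr
            refine (norm_add_le _ _).trans (add_le_add ?_ ?_)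
            · exact (norm_mul_le _ _).trans (by gcongr)
            · exact (norm_mul_le _ _).trans (by gcongr; exact hRn n)
        _ ≤ (n * ‖K‖ * d ^ n + d ^ n * ‖K‖) * d := by gcongr
        _ = _ := by push_cast; ring

/-- The words with at most one `K` have norm at most `d^m + m ‖K‖ d^(m-1)`. The approximable rest is
replaced by a finite-rank `G` with error below `d^m`, whence the coefficient 2. Since `d < ρ ^ l`,
the linear factor `m` does no harm. -/
theorem exists_pow_eq_add_of_pow_eq_add {T K R : V →L[ℂ] V} {l : ℕ} (hl : l ≠ 0)
    (hT : T ^ l = K + R) (hK : ∀ j, K * R ^ j * K ∈ approximableOperators V) {d ρ : ℝ}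
    (hR : ‖R‖ ≤ d) (hd : 0 < d) (hρ : 0 < ρ) (hdρ : d < ρ ^ l) :
    ∃ n ≠ 0, ∃ S G : V →L[ℂ] V, T ^ n = S + G ∧ (G : V →ₗ[ℂ] V).HasFiniteRange ∧
      4 * ‖S‖ ≤ ρ ^ n := by
  set q := d / ρ ^ l with hq
  have hq0 : 0 ≤ q := by positivity
  have hq1 : q < 1 := (div_lt_one (by positivity)).2 hdρ
  have hlim : Tendsto (fun m : ℕ => 4 * (2 * q ^ m + ‖K‖ / d * (m * q ^ m))) atTop (𝓝 0) := by
    have h1 := tendsto_pow_atTop_nhds_zero_of_lt_one hq0 hq1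
    have h2 := tendsto_self_mul_const_pow_of_lt_one hq0 hq1
    simpa using ((h1.const_mul 2).add (h2.const_mul (‖K‖ / d))).const_mul 4
  obtain ⟨m, hm0, hm⟩ := ((eventually_ne_atTop 0).and
    (hlim.eventually (eventually_le_nhds one_pos))).exists
  obtain ⟨B, h1, -, h3⟩ := exists_add_pow_sub_mem_approximableOperators hK hd.le hR m
  obtain ⟨G, hG, hG'⟩ := Metric.mem_closure_iff.1 h1 (d ^ m) (by positivity)
  refine ⟨l * m, mul_ne_zero hl hm0, T ^ (l * m) - G, G, by abel, hG, ?_⟩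
  have hRm : ‖R ^ m‖ ≤ d ^ m :=
    (norm_pow_le' R (Nat.pos_of_ne_zero hm0)).trans (by gcongr)
  have hB : ‖B‖ ≤ ‖K‖ / d * (m * d ^ m) := by
    rw [div_mul_eq_mul_div, le_div_iff₀ hd]
    linarith
  have hsum : ‖T ^ (l * m) - G‖ ≤ 2 * d ^ m + ‖K‖ / d * (m * d ^ m) := by
    have : T ^ (l * m) - G = R ^ m + B + ((K + R) ^ m - (R ^ m + B) - G) := by
      rw [pow_mul, hT]
      abel
    rw [this]
    have h4 : ‖(K + R) ^ m - (R ^ m + B) - G‖ < d ^ m := by rwa [← dist_eq_norm]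
    have h5 := norm_add₃_le (a := R ^ m) (b := B) (c := (K + R) ^ m - (R ^ m + B) - G)
    linarith
  have hqm : d ^ m = q ^ m * ρ ^ (l * m) := by
    rw [hq, div_pow, pow_mul]
    field_simp
  calc 4 * ‖T ^ (l * m) - G‖ ≤ 4 * (2 * d ^ m + ‖K‖ / d * (m * d ^ m)) := by gcongr
    _ = 4 * (2 * q ^ m + ‖K‖ / d * (m * q ^ m)) * ρ ^ (l * m) := by rw [hqm]; ring
    _ ≤ 1 * ρ ^ (l * m) := by gcongr
    _ = _ := one_mul _

end FiniteRankClosure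

/-! ### Completeness of the function space and composition of weighted kernels. -/

namespace PositiveKernel

instance {X : Type*} [MeasurableSpace X] : CompleteSpace (BoundedMeasurable X) := by
  suffices IsClosed (boundedMeasurableSubmodule X : Set (lp (fun _ : X => ℂ) ∞)) from
    this.completeSpace_coe
  refine isClosed_of_closure_subset fun f hf => ?_
  obtain ⟨u, hu, hlim⟩ := mem_closure_iff_seq_limit.1 hf
  refine measurable_of_tendsto_metrizable (f := fun n => (u n : X → ℂ)) hu ?_
  rw [tendsto_pi_nhds]
  intro x
  rw [tendsto_iff_norm_sub_tendsto_zero] at hlim ⊢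
  exact squeeze_zero (fun _ => norm_nonneg _)
    (fun n => lp.norm_apply_le_norm ENNReal.top_ne_zero (u n - f) x) hlim

section Instances

variable (X : Type*) [MeasurableSpace X]

scoped instance : IsTopologicalAddGroup (BoundedMeasurable X) :=
  SeminormedAddCommGroup.toIsTopologicalAddGroup

scoped instance : ContinuousAdd (BoundedMeasurable X) := IsTopologicalAddGroup.toContinuousAdd

noncomputable scoped instance : Ring (BoundedMeasurable X →L[ℂ] BoundedMeasurable X) :=
  ContinuousLinearMap.ring

noncomputable scoped instance : Monoid (BoundedMeasurable X →L[ℂ] BoundedMeasurable X) :=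
  MonoidWithZero.toMonoid

end Instances

section Composition

variable {E : Type*} [MeasurableSpace E]

theorem BoundedMeasurable.ext_eval {f g : BoundedMeasurable E} (h : ∀ x, f.eval x = g.eval x) :
    f = g :=
  Subtype.ext (lp.ext (funext h))

theorem BoundedMeasurable.norm_mk_le {f : E → ℂ} {hf : Measurable f} {C : ℝ}
    {hC : ∀ x, ‖f x‖ ≤ C} (h0 : 0 ≤ C) : ‖BoundedMeasurable.mk f hf C hC‖ ≤ C :=
  BoundedMeasurable.norm_le _ h0 hC

instance isFiniteKernel_pow (Q : Kernel E E) [IsFiniteKernel Q] (n : ℕ) :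
    IsFiniteKernel (Q ^ n) := by
  induction n with
  | zero => rw [pow_zero]; exact inferInstanceAs (IsFiniteKernel Kernel.id)
  | succ n ih => rw [pow_succ]; exact inferInstanceAs (IsFiniteKernel ((Q ^ n) ∘ₖ Q))

/-- A bounded weight depending on `x`, on `z` and on the intermediate position `y` of a
composition of kernels can be replaced by a bounded weight depending on `(x, z)` only. -/
theorem exists_twistedOp_mul [MeasurableSpace.CountablyGenerated E]
    (P Q : Kernel E E) [IsFiniteKernel P] [IsFiniteKernel Q] (a b : BoundedMeasurable (E × E)) :
    ∃ c : BoundedMeasurable (E × E), ‖c‖ ≤ ‖a‖ * ‖b‖ ∧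
      twistedOp P a * twistedOp Q b = twistedOp (Q ∘ₖ P) c := by
  set r := ‖a‖ * ‖b‖ with hr
  have hr0 : 0 ≤ r := by positivity
  let g : E × E × E → ℂ := fun p => a.eval (p.1, p.2.1) * b.eval (p.2.1, p.2.2)
  have hg : Measurable g :=
    (a.measurable_eval.comp (by fun_prop)).mul (b.measurable_eval.comp (by fun_prop))
  have hgr : ∀ p, ‖g p‖ ≤ r := fun p => by
    rw [norm_mul]
    exact mul_le_mul (a.norm_eval_le _) (b.norm_eval_le _) (norm_nonneg _) (norm_nonneg _)
  -- The weight `c (x, z)` is the conditional mean of `a (x, y) * b (y, z)` given `z`. Since `E`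
  -- need not be standard Borel, the complex value of the weight is conditioned rather than `y`; for
  -- this a countably generated `E` suffices.
  let F : E × E × E → E × ℂ := fun p => (p.2.2, g p)
  have hF : Measurable F := by fun_prop
  let ξ : Kernel E (E × E) := P ⊗ₖ Kernel.prodMkLeft E Q
  let η : Kernel E (E × E × E) := Kernel.id ×ₖ ξ
  let κ : Kernel E (E × ℂ) := η.map F
  have hη : ∀ x, η x = (ξ x).map (Prod.mk x) := fun x => by
    ext s hs
    rw [Kernel.id_prod_apply' _ _ hs, Measure.map_apply measurable_prodMk_left hs]
  have hκ : ∀ x, κ x = (ξ x).map (fun p => F (x, p)) := fun x => by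
    simp only [κ]
    rw [Kernel.map_apply _ hF, hη, Measure.map_map hF measurable_prodMk_left]
    rfl
  have hfst : κ.fst = Q ∘ₖ P := by
    rw [← Kernel.snd_compProd_prodMkLeft]
    ext x : 1
    rw [Kernel.fst_apply, hκ, Kernel.snd_apply, Measure.map_map measurable_fst (by fun_prop)]
    rfl
  -- Truncation makes the bound on `c` hold at every point, not only where the conditional law is
  -- known to live in the ball of radius `r`.
  let t : ℂ → ℂ := fun w => if ‖w‖ ≤ r then w else 0
  have ht : Measurable t :=
    Measurable.ite (measurableSet_le measurable_norm measurable_const) measurable_id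
      measurable_const
  have htr : ∀ w, ‖t w‖ ≤ r := fun w => by
    by_cases h : ‖w‖ ≤ r <;> simp [t, h, hr0]
  refine ⟨BoundedMeasurable.mk (fun p => ∫ w, t w ∂κ.condKernel p)
    (StronglyMeasurable.integral_kernel_prod_right (κ := κ.condKernel) (f := fun _ w => t w)
      (ht.comp measurable_snd).stronglyMeasurable).measurable r (fun p => ?_),
    BoundedMeasurable.norm_mk_le hr0, ?_⟩
  · simpa using norm_integral_le_of_norm_le_const (μ := κ.condKernel p)
      (Eventually.of_forall htr)
  · ext1 f
    refine BoundedMeasurable.ext_eval fun x => ?_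
    have hint : Integrable (fun q : E × ℂ => f.eval q.1 * t q.2) (κ x) := by
      refine Integrable.of_bound (C := ‖f‖ * r) ((f.measurable_eval.comp measurable_fst).mul
        (ht.comp measurable_snd)).aestronglyMeasurable (Eventually.of_forall fun q => ?_)
      rw [norm_mul]
      exact mul_le_mul (f.norm_eval_le _) (htr _) (norm_nonneg _) (norm_nonneg _)
    have hint' : Integrable (fun p : E × E => f.eval p.2 * g (x, p)) (ξ x) := by
      refine Integrable.of_bound (C := ‖f‖ * r) ((f.measurable_eval.comp measurable_snd).mul
        (hg.comp measurable_prodMk_left)).aestronglyMeasurable (Eventually.of_forall fun q => ?_)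
      rw [norm_mul]
      exact mul_le_mul (f.norm_eval_le _) (hgr _) (norm_nonneg _) (norm_nonneg _)
    have hleft : (twistedOp P a (twistedOp Q b f)).eval x =
        ∫ p, f.eval p.2 * g (x, p) ∂ξ x := by
      rw [ProbabilityTheory.integral_compProd hint', twistedOp_apply]
      refine integral_congr_ae (Eventually.of_forall fun y => ?_)
      simp only [twistedOp_apply, Kernel.prodMkLeft_apply]
      rw [← integral_mul_const]
      refine integral_congr_ae (Eventually.of_forall fun z => ?_)
      simp only [g]
      ring
    have hright : ∫ p, f.eval p.2 * g (x, p) ∂ξ x = ∫ q, f.eval q.1 * t q.2 ∂κ x := by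
      rw [hκ, integral_map (by fun_prop)]
      · refine integral_congr_ae (Eventually.of_forall fun p => ?_)
        simp [F, t, hgr]
      · rw [← hκ]
        exact hint.1
    change (twistedOp P a (twistedOp Q b f)).eval x = _
    rw [hleft, hright, ← integral_condKernel x hint, hfst, twistedOp_apply]
    refine integral_congr_ae (Eventually.of_forall fun y => ?_)
    exact integral_const_mul (f.eval y) t

theorem exists_twistedOp_pow [MeasurableSpace.CountablyGenerated E]
    (Q : Kernel E E) [IsFiniteKernel Q] (χ : BoundedMeasurable (E × E)) (n : ℕ) :
    ∃ c : BoundedMeasurable (E × E), ‖c‖ ≤ ‖χ‖ ^ n ∧ twistedOp Q χ ^ n = twistedOp (Q ^ n) c := by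
  induction n with
  | zero =>
    refine ⟨BoundedMeasurable.mk (fun _ => 1) measurable_const 1 (by simp), ?_, ?_⟩
    · rw [pow_zero]
      exact BoundedMeasurable.norm_mk_le zero_le_one
    · ext1 f
      refine BoundedMeasurable.ext_eval fun x => ?_
      rw [twistedOp_apply]
      change f.eval x = ∫ y, f.eval y * 1 ∂(Kernel.id x)
      rw [Kernel.id_apply, integral_dirac' _ _ (by
        simpa using f.measurable_eval.stronglyMeasurable), mul_one]
  | succ n ih =>
    obtain ⟨c, hc, h⟩ := ih
    obtain ⟨c', hc', h'⟩ := exists_twistedOp_mul Q (Q ^ n) χ c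
    refine ⟨c', hc'.trans ?_, ?_⟩
    · rw [pow_succ']
      gcongr
    · rw [pow_succ', h, h']
      rfl

/-- The weight is the constant `1`; its norm is only bounded by `1` because `E` may be empty. -/
theorem kernelOp_eq_twistedOp_one (Q : Kernel E E) [IsFiniteKernel Q] :
    ∃ χ : BoundedMeasurable (E × E), ‖χ‖ ≤ 1 ∧ kernelOp Q = twistedOp Q χ := by
  refine ⟨BoundedMeasurable.mk (fun _ => 1) measurable_const 1 (by simp),
    BoundedMeasurable.norm_mk_le zero_le_one, ?_⟩
  ext1 f
  refine BoundedMeasurable.ext_eval fun x => ?_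
  rw [twistedOp_apply, kernelOp_apply]
  change _ = ∫ y, f.eval y * 1 ∂Q x
  simp

end Composition

/-! ### Splitting off a bounded density with respect to `ν`. -/

section Decomposition

variable {E : Type*} [MeasurableSpace E]

theorem exists_forall_measure_le_of_doeblinDelta_lt {ν : Measure E} {N : Kernel E E} {d : ℝ≥0∞}
    (h : doeblinDelta ν N < d) :
    ∃ η > 0, ∀ A, MeasurableSet A → ν A < η → ∀ x, N x A ≤ d := by
  have hev := eventually_lt_of_limsup_lt h
  obtain ⟨s, hs, hsub⟩ := mem_comap.1 hev
  obtain ⟨η, hη, hη'⟩ := ENNReal.nhds_zero_basis.mem_iff.1 hs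
  refine ⟨η, hη, fun A hA hνA x => ?_⟩
  have : (⨆ x, N x A) < d := hsub (show (⟨A, hA⟩ : {A : Set E // MeasurableSet A}) ∈ _ from hη' hνA)
  exact (le_iSup (fun x => N x A) x).trans this.le

/-- `G` is the region off the singular part where the jointly measurable Radon-Nikodym density is at
most `M`. By Markov's inequality, slices of its complement have `ν`-measure at most `N.bound / M`,
uniformly in `x`. For `M` large this is below the threshold that forces `N x` to be at most `d`. -/
theorem exists_density_on_set_of_doeblinDelta_lt [MeasurableSpace.CountablyGenerated E]
    {ν : Measure E} [IsProbabilityMeasure ν] {N : Kernel E E} [IsFiniteKernel N] {d : ℝ≥0∞}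
    (h : doeblinDelta ν N < d) :
    ∃ (G : Set (E × E)) (q : E × E → ℝ≥0∞) (M : ℝ≥0), MeasurableSet G ∧ Measurable q ∧
      (∀ p ∈ G, q p ≤ M) ∧
      (∀ x, (N x).restrict (Prod.mk x ⁻¹' G) =
        (ν.restrict (Prod.mk x ⁻¹' G)).withDensity (fun y => q (x, y))) ∧
      ∀ x, N x (Prod.mk x ⁻¹' Gᶜ) ≤ d := by
  obtain ⟨η, hη, hN⟩ := exists_forall_measure_le_of_doeblinDelta_lt h
  set κ : Kernel E E := Kernel.const E ν with hκ
  set q : E × E → ℝ≥0∞ := fun p => N.rnDeriv κ p.1 p.2 with hq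
  have hqm : Measurable q := Kernel.measurable_rnDeriv N κ
  obtain ⟨M, hM0, hM⟩ : ∃ M : ℝ≥0, M ≠ 0 ∧ N.bound / M < η := by
    obtain ⟨n, hn⟩ := ENNReal.exists_nat_mul_gt hη.ne' N.bound_ne_top
    refine ⟨n + 1, by positivity, ?_⟩
    rw [ENNReal.div_lt_iff (by simp) (by simp)]
    refine hn.trans_le ?_
    rw [mul_comm]
    gcongr
    push_cast
    exact le_self_add
  refine ⟨(Kernel.mutuallySingularSet N κ)ᶜ ∩ {p | q p ≤ M}, q, M,
    (Kernel.measurableSet_mutuallySingularSet N κ).compl.inter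
      (measurableSet_le hqm measurable_const), hqm, fun p hp => hp.2, fun x => ?_, fun x => ?_⟩
  · set S := Prod.mk x ⁻¹' ((Kernel.mutuallySingularSet N κ)ᶜ ∩ {p | q p ≤ M})
    have hS : MeasurableSet S := measurable_prodMk_left
      ((Kernel.measurableSet_mutuallySingularSet N κ).compl.inter
        (measurableSet_le hqm measurable_const))
    rw [← restrict_withDensity hS]
    ext t ht
    rw [Measure.restrict_apply ht, Measure.restrict_apply ht,
      ← Kernel.withDensity_rnDeriv_of_subset_compl_mutuallySingularSetSlice (κ := N) (η := κ)
        (a := x) (ht.inter hS) (fun y hy => hy.2.1),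
      Kernel.withDensity_apply _ (by exact hqm)]
    rfl
  · refine hN _ (measurable_prodMk_left ((Kernel.measurableSet_mutuallySingularSet N κ).compl.inter
        (measurableSet_le hqm measurable_const)).compl) ?_ x
    have hsub : Prod.mk x ⁻¹' ((Kernel.mutuallySingularSet N κ)ᶜ ∩ {p | q p ≤ M})ᶜ ⊆
        Kernel.mutuallySingularSetSlice N κ x ∪ {y | (M : ℝ≥0∞) ≤ q (x, y)} := by
      intro y hy
      by_cases h1 : (x, y) ∈ Kernel.mutuallySingularSet N κ
      · exact Or.inl h1
      · refine Or.inr ?_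
        by_contra h2
        exact hy ⟨h1, show q (x, y) ≤ M from (not_le.1 h2).le⟩
    have hnull : ν (Kernel.mutuallySingularSetSlice N κ x) = 0 :=
      Kernel.measure_mutuallySingularSetSlice N κ x
    have hint : ∫⁻ y, q (x, y) ∂ν ≤ N.bound := by
      calc ∫⁻ y, q (x, y) ∂ν = (κ.withDensity (N.rnDeriv κ)) x Set.univ := by
            rw [Kernel.withDensity_apply _ (by exact hqm), withDensity_apply _ MeasurableSet.univ,
              Measure.restrict_univ]
            rfl
        _ ≤ N x Set.univ := Kernel.withDensity_rnDeriv_le N κ x _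
        _ ≤ N.bound := Kernel.measure_le_bound N x _
    calc ν _ ≤ ν (Kernel.mutuallySingularSetSlice N κ x) + ν {y | (M : ℝ≥0∞) ≤ q (x, y)} :=
          (measure_mono hsub).trans (measure_union_le _ _)
      _ ≤ N.bound / M := by
          rw [hnull, zero_add]
          refine (meas_ge_le_lintegral_div (by fun_prop) (by simpa using hM0) (by simp)).trans ?_
          gcongr
      _ < η := hM

/-- A kernel operator is the sum of an operator with a bounded density and of an operator whose
norm is controlled by `doeblinDelta`. -/
theorem exists_twistedOp_eq_add [MeasurableSpace.CountablyGenerated E]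
    {ν : Measure E} [IsProbabilityMeasure ν] {N : Kernel E E} [IsFiniteKernel N] {d : ℝ≥0}
    (h : doeblinDelta ν N < d) (c : BoundedMeasurable (E × E)) :
    ∃ k c' : BoundedMeasurable (E × E),
      twistedOp N c = twistedOp (Kernel.const E ν) k + twistedOp N c' ∧
      ‖twistedOp N c'‖ ≤ ‖c‖ * d := by
  classical
  obtain ⟨G, q, M, hG, hq, hqM, hdens, hd⟩ := exists_density_on_set_of_doeblinDelta_lt h
  let k : BoundedMeasurable (E × E) := BoundedMeasurable.mk
    (G.indicator fun p => c.eval p * ((q p).toReal : ℂ))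
    (Measurable.indicator (c.measurable_eval.mul (by fun_prop)) hG) (‖c‖ * M) (fun p => by
      by_cases hp : p ∈ G
      · rw [Set.indicator_of_mem hp, norm_mul]
        refine mul_le_mul (c.norm_eval_le p) ?_ (norm_nonneg _) (norm_nonneg _)
        rw [Complex.norm_real, Real.norm_of_nonneg ENNReal.toReal_nonneg]
        exact ENNReal.toReal_le_coe_of_le_coe (hqM p hp)
      · rw [Set.indicator_of_notMem hp, norm_zero]
        positivity)
  -- The remainder stays a weighted operator over `N`, which is what lets its powers preserve
  -- domination by a finite measure.
  let c' : BoundedMeasurable (E × E) := BoundedMeasurable.mk (Gᶜ.indicator c.eval)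
    (c.measurable_eval.indicator hG.compl) ‖c‖ (fun p =>
      (norm_indicator_le_norm_self _ _).trans (c.norm_eval_le p))
  have hGx : ∀ x, MeasurableSet (Prod.mk x ⁻¹' G) := fun x => measurable_prodMk_left hG
  have hc' : ∀ (f : BoundedMeasurable E) x, (twistedOp N c' f).eval x =
      ∫ y in (Prod.mk x ⁻¹' G)ᶜ, f.eval y * c.eval (x, y) ∂N x := by
    intro f x
    rw [twistedOp_apply, ← integral_indicator (hGx x).compl]
    refine integral_congr_ae (Eventually.of_forall fun y => ?_)
    change f.eval y * Gᶜ.indicator c.eval (x, y) = _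
    by_cases hy : (x, y) ∈ G <;> simp [Set.indicator, hy]
  refine ⟨k, c', ?_, ?_⟩
  · ext1 f
    refine BoundedMeasurable.ext_eval fun x => ?_
    change _ = (twistedOp (Kernel.const E ν) k f).eval x + (twistedOp N c' f).eval x
    rw [hc', twistedOp_apply, ← integral_add_compl (hGx x) (integrable_eval_mul N c f x),
      twistedOp_apply, Kernel.const_apply]
    congr 1
    rw [hdens, integral_withDensity_eq_integral_toReal_smul (by fun_prop),
      ← integral_indicator (hGx x)]
    · refine integral_congr_ae (Eventually.of_forall fun y => ?_)
      change _ = f.eval y * G.indicator (fun p => c.eval p * ((q p).toReal : ℂ)) (x, y)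
      by_cases hy : (x, y) ∈ G
      · simp [Set.indicator, hy]
        ring
      · simp [Set.indicator, hy]
    · refine (ae_restrict_iff' (hGx x)).2 (Eventually.of_forall fun y hy => ?_)
      exact (hqM _ hy).trans_lt ENNReal.coe_lt_top
  · refine ContinuousLinearMap.opNorm_le_bound _ (by positivity) fun f => ?_
    refine BoundedMeasurable.norm_le _ (by positivity) fun x => ?_
    rw [hc']
    have hb := norm_integral_le_of_norm_le_const (μ := (N x).restrict (Prod.mk x ⁻¹' G)ᶜ)
      (f := fun y => f.eval y * c.eval (x, y)) (C := ‖f‖ * ‖c‖) (Eventually.of_forall fun y => by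
        rw [norm_mul]
        exact mul_le_mul (f.norm_eval_le _) (c.norm_eval_le _) (norm_nonneg _) (norm_nonneg _))
    refine hb.trans ?_
    have : ((N x).restrict (Prod.mk x ⁻¹' G)ᶜ).real Set.univ ≤ d := by
      rw [measureReal_restrict_apply MeasurableSet.univ, Set.univ_inter]
      exact ENNReal.toReal_le_coe_of_le_coe (hd x)
    calc _ ≤ ‖f‖ * ‖c‖ * d := by gcongr
      _ = _ := by ring

end Decomposition

/-! ### Domination by a measure and approximation by finite rank. -/

section Domination

variable {E : Type*} [MeasurableSpace E]

/-- `|W g| ≤ ∫ |g| dμ` for every bounded measurable function `g`. -/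
def IsDominatedBy (W : BoundedMeasurable E →L[ℂ] BoundedMeasurable E) (μ : Measure E) : Prop :=
  ∀ (g : BoundedMeasurable E) (x : E), ‖(W g).eval x‖ ≤ ∫ y, ‖g.eval y‖ ∂μ

theorem integrable_eval_measure {X : Type*} [MeasurableSpace X] (μ : Measure X) [IsFiniteMeasure μ]
    (g : BoundedMeasurable X) : Integrable g.eval μ :=
  Integrable.of_bound (C := ‖g‖) g.measurable_eval.aestronglyMeasurable
    (Eventually.of_forall g.norm_eval_le)

theorem norm_twistedOp_eval_le (N : Kernel E E) [IsFiniteKernel N] (c : BoundedMeasurable (E × E))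
    (g : BoundedMeasurable E) (x : E) :
    ‖(twistedOp N c g).eval x‖ ≤ ‖c‖ * ∫ y, ‖g.eval y‖ ∂N x := by
  rw [twistedOp_apply, ← integral_const_mul]
  refine norm_integral_le_of_norm_le ((integrable_eval N g x).norm.const_mul _)
    (Eventually.of_forall fun y => ?_)
  rw [norm_mul, mul_comm]
  gcongr
  exact c.norm_eval_le _

theorem isDominatedBy_twistedOp_const (ν : Measure E) [IsFiniteMeasure ν]
    (k : BoundedMeasurable (E × E)) :
    IsDominatedBy (twistedOp (Kernel.const E ν) k) (‖k‖₊ • ν) := by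
  intro g x
  refine (norm_twistedOp_eval_le _ k g x).trans_eq ?_
  rw [Kernel.const_apply, integral_smul_nnreal_measure]
  rfl

theorem IsDominatedBy.mul_twistedOp {W : BoundedMeasurable E →L[ℂ] BoundedMeasurable E}
    {μ : Measure E} [IsFiniteMeasure μ] (hW : IsDominatedBy W μ) (N : Kernel E E)
    [IsFiniteKernel N] (c : BoundedMeasurable (E × E)) :
    IsDominatedBy (W * twistedOp N c) (‖c‖₊ • (N ∘ₖ Kernel.const Unit μ) ()) := by
  intro g x
  refine (hW (twistedOp N c g) x).trans ?_
  have hint : Integrable (fun y => ‖g.eval y‖) ((N ∘ₖ Kernel.const Unit μ) ()) :=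
    (integrable_eval_measure _ g).norm
  rw [integral_smul_nnreal_measure, Kernel.integral_comp hint, Kernel.const_apply]
  change _ ≤ ‖c‖ * ∫ x, ∫ y, ‖g.eval y‖ ∂N x ∂μ
  rw [← integral_const_mul]
  refine integral_mono (integrable_eval_measure μ _).norm ?_ (norm_twistedOp_eval_le N c g)
  have := hint.integral_comp
  rw [Kernel.const_apply] at this
  exact this.const_mul _

theorem exists_isDominatedBy_mul_pow {W : BoundedMeasurable E →L[ℂ] BoundedMeasurable E}
    {μ : Measure E} [IsFiniteMeasure μ] (hW : IsDominatedBy W μ) (N : Kernel E E)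
    [IsFiniteKernel N] (c : BoundedMeasurable (E × E)) (j : ℕ) :
    ∃ μ' : Measure E, IsFiniteMeasure μ' ∧ IsDominatedBy (W * twistedOp N c ^ j) μ' := by
  induction j with
  | zero => exact ⟨μ, inferInstance, by rwa [pow_zero, mul_one]⟩
  | succ j ih =>
    obtain ⟨μ', hμ', h⟩ := ih
    exact ⟨_, inferInstance, by
      rw [pow_succ, ← mul_assoc]
      exact h.mul_twistedOp N c⟩

/-- The left factor `W` integrates out the first variable of `k`, turning a supremum over it into an
integral. This is why two factors `K` are approximable even though the norm is a supremum. -/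
theorem IsDominatedBy.norm_mul_twistedOp_const_le
    {W : BoundedMeasurable E →L[ℂ] BoundedMeasurable E} {μ : Measure E} [IsFiniteMeasure μ]
    (hW : IsDominatedBy W μ) (ν : Measure E) [IsFiniteMeasure ν]
    (k : BoundedMeasurable (E × E)) :
    ‖W * twistedOp (Kernel.const E ν) k‖ ≤ ∫ p, ‖k.eval p‖ ∂(μ.prod ν) := by
  have h0 : 0 ≤ ∫ p, ‖k.eval p‖ ∂(μ.prod ν) := integral_nonneg fun _ => norm_nonneg _
  have hint : Integrable (fun p => ‖k.eval p‖) (μ.prod ν) := (integrable_eval_measure _ k).norm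
  refine ContinuousLinearMap.opNorm_le_bound _ h0 fun f => ?_
  refine BoundedMeasurable.norm_le _ (by positivity) fun x => ?_
  refine (hW (twistedOp (Kernel.const E ν) k f) x).trans ?_
  rw [integral_prod _ hint, ← integral_mul_const]
  refine integral_mono (integrable_eval_measure μ _).norm (hint.integral_prod_left.mul_const _)
    fun y => ?_
  change ‖(twistedOp (Kernel.const E ν) k f).eval y‖ ≤ (∫ z, ‖k.eval (y, z)‖ ∂ν) * ‖f‖
  rw [twistedOp_apply, Kernel.const_apply, ← integral_mul_const]
  refine norm_integral_le_of_norm_le ?_ (Eventually.of_forall fun z => ?_)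
  · refine (Integrable.of_bound (C := ‖k‖) ?_ (Eventually.of_forall fun z => ?_)).mul_const _
    · exact (k.measurable_eval.comp measurable_prodMk_left).norm.aestronglyMeasurable
    · rw [norm_norm]
      exact k.norm_eval_le _
  · rw [norm_mul, mul_comm]
    gcongr
    exact f.norm_eval_le _

theorem twistedOp_add (N : Kernel E E) [IsFiniteKernel N] (a b : BoundedMeasurable (E × E)) :
    twistedOp N (a + b) = twistedOp N a + twistedOp N b := by
  ext1 f
  refine BoundedMeasurable.ext_eval fun x => ?_
  change _ = (twistedOp N a f).eval x + (twistedOp N b f).eval x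
  rw [twistedOp_apply, twistedOp_apply, twistedOp_apply,
    ← integral_add (integrable_eval_mul N a f x) (integrable_eval_mul N b f x)]
  exact integral_congr_ae (Eventually.of_forall fun y => mul_add (f.eval y) _ _)

theorem twistedOp_sub (N : Kernel E E) [IsFiniteKernel N] (a b : BoundedMeasurable (E × E)) :
    twistedOp N (a - b) = twistedOp N a - twistedOp N b := by
  rw [eq_sub_iff_add_eq, ← twistedOp_add, sub_add_cancel]

/-- The function equal to `c` on a measurable set and to `0` elsewhere. -/
noncomputable def BoundedMeasurable.indicatorConst {X : Type*} [MeasurableSpace X] (s : Set X)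
    (hs : MeasurableSet s) (c : ℂ) : BoundedMeasurable X :=
  BoundedMeasurable.mk (s.indicator fun _ => c) (measurable_const.indicator hs) ‖c‖ fun x =>
    norm_indicator_le_norm_self _ x

theorem IsDominatedBy.mul_twistedOp_const_mem_of_tendsto
    {W : BoundedMeasurable E →L[ℂ] BoundedMeasurable E} {μ : Measure E} [IsFiniteMeasure μ]
    (hW : IsDominatedBy W μ) (ν : Measure E) [IsFiniteMeasure ν]
    {k : BoundedMeasurable (E × E)} {u : ℕ → BoundedMeasurable (E × E)} {C : ℝ}
    (hu : ∀ n, W * twistedOp (Kernel.const E ν) (u n) ∈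
      approximableOperators (BoundedMeasurable E))
    (hC : ∀ n p, ‖(u n).eval p‖ ≤ C)
    (hlim : ∀ p, Tendsto (fun n => (u n).eval p) atTop (𝓝 (k.eval p))) :
    W * twistedOp (Kernel.const E ν) k ∈ approximableOperators (BoundedMeasurable E) := by
  have h0 : Tendsto (fun n => ∫ p, ‖(u n - k).eval p‖ ∂(μ.prod ν)) atTop (𝓝 0) := by
    have : Tendsto (fun n => ∫ p, ‖(u n - k).eval p‖ ∂(μ.prod ν)) atTop
        (𝓝 (∫ _, (0 : ℝ) ∂(μ.prod ν))) := by
      refine tendsto_integral_of_dominated_convergence (fun _ => C + ‖k‖)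
        (fun n => (u n - k).measurable_eval.norm.aestronglyMeasurable) (integrable_const _)
        (fun n => Eventually.of_forall fun p => ?_) (Eventually.of_forall fun p => ?_)
      · rw [norm_norm]
        exact (norm_sub_le _ _).trans (add_le_add (hC n p) (k.norm_eval_le p))
      · exact tendsto_iff_norm_sub_tendsto_zero.1 (hlim p)
    simpa using this
  refine mem_approximableOperators_of_norm_sub_le hu (fun n => ?_) h0
  rw [← mul_sub, ← twistedOp_sub]
  exact hW.norm_mul_twistedOp_const_le ν _

theorem hasFiniteRange_twistedOp_const_rectangle (ν : Measure E) [IsFiniteMeasure ν]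
    {A B : Set E} (hA : MeasurableSet A) (hB : MeasurableSet B) (c : ℂ) :
    (twistedOp (Kernel.const E ν) (BoundedMeasurable.indicatorConst (A ×ˢ B) (hA.prod hB) c) :
      BoundedMeasurable E →ₗ[ℂ] BoundedMeasurable E).HasFiniteRange := by
  rw [LinearMap.hasFiniteRange_iff_range]
  have hle : LinearMap.range (twistedOp (Kernel.const E ν)
      (BoundedMeasurable.indicatorConst (A ×ˢ B) (hA.prod hB) c) :
      BoundedMeasurable E →ₗ[ℂ] BoundedMeasurable E) ≤
      Submodule.span ℂ {BoundedMeasurable.indicatorConst A hA 1} := by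
    rintro _ ⟨f, rfl⟩
    rw [Submodule.mem_span_singleton]
    refine ⟨(∫ y in B, f.eval y ∂ν) * c, BoundedMeasurable.ext_eval fun x => ?_⟩
    change (∫ y in B, f.eval y ∂ν) * c * A.indicator (fun _ => 1) x =
      ∫ y, f.eval y * (A ×ˢ B).indicator (fun _ => c) (x, y) ∂ν
    rw [← integral_indicator hB, ← integral_mul_const, ← integral_mul_const]
    refine integral_congr_ae (Eventually.of_forall fun y => ?_)
    by_cases hx : x ∈ A <;> by_cases hy : y ∈ B <;> simp [Set.indicator, hx, hy]
  have := Submodule.finiteDimensional_of_le hle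
  exact Module.Finite.iff_fg.1 this

/-- A `π`-`λ` argument: a rectangle gives rank at most one, and countable disjoint unions pass to
the limit by dominated convergence in `L¹(μ ⊗ ν)`. -/
theorem IsDominatedBy.mul_twistedOp_const_indicator_mem
    {W : BoundedMeasurable E →L[ℂ] BoundedMeasurable E} {μ : Measure E} [IsFiniteMeasure μ]
    (hW : IsDominatedBy W μ) (ν : Measure E) [IsFiniteMeasure ν] (s : Set (E × E))
    (hs : MeasurableSet s) (c : ℂ) :
    W * twistedOp (Kernel.const E ν) (BoundedMeasurable.indicatorConst s hs c) ∈
      approximableOperators (BoundedMeasurable E) := by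
  have hrect : ∀ (A B : Set E) (hA : MeasurableSet A) (hB : MeasurableSet B),
      W * twistedOp (Kernel.const E ν) (BoundedMeasurable.indicatorConst (A ×ˢ B) (hA.prod hB) c) ∈
        approximableOperators (BoundedMeasurable E) := fun A B hA hB =>
    mul_mem_approximableOperators_left (mem_approximableOperators_of_hasFiniteRange
      (hasFiniteRange_twistedOp_const_rectangle ν hA hB c)) W
  induction s, hs using MeasurableSpace.induction_on_inter generateFrom_prod.symm isPiSystem_prod with
  | empty =>
    have h := hrect ∅ ∅ MeasurableSet.empty MeasurableSet.empty
    simpa only [Set.empty_prod] using h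
  | basic t ht =>
    obtain ⟨A, hA, B, hB, rfl⟩ := ht
    exact hrect A B hA hB
  | compl t htm ih =>
    have h := hrect Set.univ Set.univ MeasurableSet.univ MeasurableSet.univ
    have heq : BoundedMeasurable.indicatorConst tᶜ htm.compl c =
        BoundedMeasurable.indicatorConst (Set.univ ×ˢ Set.univ)
          (MeasurableSet.univ.prod MeasurableSet.univ) c - BoundedMeasurable.indicatorConst t htm c := by
      refine BoundedMeasurable.ext_eval fun p => ?_
      change tᶜ.indicator (fun _ => c) p =
        (Set.univ ×ˢ Set.univ : Set (E × E)).indicator (fun _ => c) p - t.indicator (fun _ => c) p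
      by_cases hp : p ∈ t <;> simp [hp]
    rw [heq, twistedOp_sub, mul_sub]
    exact sub_mem h ih
  | iUnion f hd hfm ih =>
    have hU : ∀ n, MeasurableSet (⋃ i ∈ Finset.range n, f i) := fun n =>
      Finset.measurableSet_biUnion _ fun i _ => hfm i
    refine hW.mul_twistedOp_const_mem_of_tendsto ν
      (u := fun n => BoundedMeasurable.indicatorConst _ (hU n) c) (C := ‖c‖) (fun n => ?_)
      (fun n p => norm_indicator_le_norm_self (fun _ => c) p) (fun p => ?_)
    · induction n with
      | zero => simpa [Set.empty_prod] using hrect ∅ ∅ MeasurableSet.empty MeasurableSet.empty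
      | succ n ihn =>
        have heq : BoundedMeasurable.indicatorConst _ (hU (n + 1)) c =
            BoundedMeasurable.indicatorConst _ (hU n) c +
              BoundedMeasurable.indicatorConst _ (hfm n) c := by
          refine BoundedMeasurable.ext_eval fun p => ?_
          change (⋃ i ∈ Finset.range (n + 1), f i).indicator (fun _ => c) p =
            (⋃ i ∈ Finset.range n, f i).indicator (fun _ => c) p +
              (f n).indicator (fun _ => c) p
          rw [Finset.range_add_one, Finset.set_biUnion_insert, Set.union_comm,
            Set.indicator_union_of_disjoint]
          rw [Set.disjoint_iUnion₂_left]
          exact fun i hi => hd (Finset.mem_range.1 hi).ne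
        rw [heq, twistedOp_add, mul_add]
        exact add_mem ihn (ih n)
    · change Tendsto (fun n => (⋃ i ∈ Finset.range n, f i).indicator (fun _ => c) p) atTop
        (𝓝 ((⋃ i, f i).indicator (fun _ => c) p))
      by_cases hp : p ∈ ⋃ i, f i
      · obtain ⟨i, hi⟩ := Set.mem_iUnion.1 hp
        refine tendsto_const_nhds.congr' ?_
        filter_upwards [eventually_gt_atTop i] with n hn
        rw [Set.indicator_of_mem hp, Set.indicator_of_mem]
        exact Set.mem_biUnion (Finset.mem_coe.2 (Finset.mem_range.2 hn)) hi
      · refine tendsto_const_nhds.congr fun n => ?_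
        rw [Set.indicator_of_notMem hp, Set.indicator_of_notMem]
        exact fun h => hp (Set.iUnion₂_subset_iUnion _ _ h)

theorem IsDominatedBy.mul_twistedOp_const_mem
    {W : BoundedMeasurable E →L[ℂ] BoundedMeasurable E} {μ : Measure E} [IsFiniteMeasure μ]
    (hW : IsDominatedBy W μ) (ν : Measure E) [IsFiniteMeasure ν]
    (k : BoundedMeasurable (E × E)) :
    W * twistedOp (Kernel.const E ν) k ∈ approximableOperators (BoundedMeasurable E) := by
  have hsimple : ∀ (g : SimpleFunc (E × E) ℂ) (k : BoundedMeasurable (E × E)),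
      (∀ p, k.eval p = g p) →
      W * twistedOp (Kernel.const E ν) k ∈ approximableOperators (BoundedMeasurable E) := by
    intro g
    induction g using SimpleFunc.induction with
    | const c hs =>
      rename_i s
      intro k hk
      have : k = BoundedMeasurable.indicatorConst s hs c := by
        refine BoundedMeasurable.ext_eval fun p => ?_
        rw [hk]
        change _ = s.indicator (fun _ => c) p
        by_cases hp : p ∈ s <;> simp [hp]
      rw [this]
      exact hW.mul_twistedOp_const_indicator_mem ν s hs c
    | @add f g _ hf hg =>
      intro k hk
      obtain ⟨C, hC⟩ := SimpleFunc.exists_forall_norm_le f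
      obtain ⟨D, hD⟩ := SimpleFunc.exists_forall_norm_le g
      have : k = BoundedMeasurable.mk f f.measurable C hC +
          BoundedMeasurable.mk g g.measurable D hD :=
        BoundedMeasurable.ext_eval hk
      rw [this, twistedOp_add, mul_add]
      exact add_mem (hf _ fun _ => rfl) (hg _ fun _ => rfl)
  have hk := k.measurable_eval.stronglyMeasurable
  exact hW.mul_twistedOp_const_mem_of_tendsto ν
    (u := fun n => BoundedMeasurable.mk (hk.approxBounded ‖k‖ n)
      (hk.approxBounded ‖k‖ n).measurable ‖k‖ (hk.norm_approxBounded_le (norm_nonneg k) n))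
    (C := ‖k‖) (fun n => hsimple _ _ fun _ => rfl)
    (fun n p => hk.norm_approxBounded_le (norm_nonneg k) n p)
    (fun p => hk.tendsto_approxBounded_of_norm_le (k.norm_eval_le p))

end Domination

/-! ### The bound on the essential spectral radius. -/

section EssentialSpectralRadius

variable {E : Type*} [MeasurableSpace E] [MeasurableSpace.CountablyGenerated E]

theorem hasSpectralSplitting_twistedOp (Q : Kernel E E) [IsFiniteKernel Q] {l : ℕ} (hl : l ≠ 0)
    (ν : Measure E) [IsProbabilityMeasure ν] (χ : BoundedMeasurable (E × E)) {d ρ : ℝ≥0}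
    (hd : doeblinDelta ν (Q ^ l) < d) (hρ : ‖χ‖ ^ l * d < (ρ : ℝ) ^ l) :
    HasSpectralSplitting (twistedOp Q χ) ρ := by
  have hρ0 : 0 < ρ := by
    rcases eq_zero_or_pos ρ with rfl | h
    · rw [NNReal.coe_zero, zero_pow hl] at hρ
      exact absurd hρ (not_lt.2 (by positivity))
    · exact h
  obtain ⟨c, hc, hpow⟩ := exists_twistedOp_pow Q χ l
  obtain ⟨k, c', hadd, hR⟩ := exists_twistedOp_eq_add hd c
  -- The intermediate `e` is a strictly positive bound for the remainder even when `‖χ‖ = 0`.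
  obtain ⟨e, he, heρ⟩ := exists_between hρ
  have he0 : 0 < e := lt_of_le_of_lt (by positivity) he
  have hR' : ‖twistedOp (Q ^ l) c'‖ ≤ e :=
    hR.trans ((mul_le_mul_of_nonneg_right hc d.2).trans he.le)
  have hK : ∀ j, twistedOp (Kernel.const E ν) k * twistedOp (Q ^ l) c' ^ j *
      twistedOp (Kernel.const E ν) k ∈ approximableOperators (BoundedMeasurable E) := by
    intro j
    obtain ⟨μ, _, hμ⟩ := exists_isDominatedBy_mul_pow (isDominatedBy_twistedOp_const ν k)
      (Q ^ l) c' j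
    exact hμ.mul_twistedOp_const_mem ν k
  obtain ⟨n, hn, S, G, hT, hG, hS⟩ := exists_pow_eq_add_of_pow_eq_add hl (hpow.trans hadd) hK hR'
    he0 (NNReal.coe_pos.2 hρ0) heρ
  exact hasSpectralSplitting_of_pow_eq_add hn hρ0 hT hG hS

theorem essentialSpectralRadius_twistedOp_le (Q : Kernel E E) [IsFiniteKernel Q] {l : ℕ}
    (hl : l ≠ 0) (ν : Measure E) [IsProbabilityMeasure ν] (hν : doeblinDelta ν (Q ^ l) ≠ ∞)
    (χ : BoundedMeasurable (E × E)) :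
    essentialSpectralRadius (twistedOp Q χ) ≤
      ‖χ‖ₑ * doeblinDelta ν (Q ^ l) ^ (1 / (l : ℝ)) := by
  refine le_of_forall_gt_imp_ge_of_dense fun b hb => ?_
  obtain ⟨ρ, hρ, hρb⟩ := ENNReal.lt_iff_exists_nnreal_btwn.1 hb
  suffices hs : HasSpectralSplitting (twistedOp Q χ) ρ from
    (sInf_le (a := (ρ : ℝ≥0∞)) (Or.inr ⟨ρ, hs, rfl⟩)).trans hρb.le
  obtain ⟨δ, hδ⟩ : ∃ δ : ℝ≥0, (δ : ℝ≥0∞) = doeblinDelta ν (Q ^ l) := ⟨_, ENNReal.coe_toNNReal hν⟩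
  have hlt : ‖χ‖₊ ^ l * δ < ρ ^ l := by
    have h := ENNReal.pow_lt_pow_left hl hρ
    rw [mul_pow, ← ENNReal.rpow_natCast (_ ^ (1 / (l : ℝ))), ← ENNReal.rpow_mul,
      one_div_mul_cancel (Nat.cast_ne_zero.2 hl), ENNReal.rpow_one, ← hδ, enorm_eq_nnnorm] at h
    exact_mod_cast h
  have hlim : Tendsto (fun d : ℝ≥0 => ‖χ‖₊ ^ l * d) (𝓝[>] δ) (𝓝 (‖χ‖₊ ^ l * δ)) :=
    ((continuous_const.mul continuous_id).tendsto δ).mono_left nhdsWithin_le_nhds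
  obtain ⟨d, hd, hδd⟩ := ((hlim.eventually_lt_const hlt).and self_mem_nhdsWithin).exists
  refine hasSpectralSplitting_twistedOp Q hl ν χ (d := d) ?_ (by exact_mod_cast hd)
  rw [← hδ]
  exact ENNReal.coe_lt_coe.2 hδd

end EssentialSpectralRadius

end PositiveKernel

theorem mainTheorem4 {E : Type*} [MeasurableSpace E] [MeasurableSpace.CountablyGenerated E]
    (Q : Kernel E E) [IsFiniteKernel Q] (ℓ : ℕ) (hℓ : 1 ≤ ℓ)
    (ν : Measure E) [IsProbabilityMeasure ν]
    (hΔ : PositiveKernel.doeblinDelta ν (Q ^ ℓ) ^ (1 / (ℓ : ℝ)) <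
      spectralRadius ℂ (PositiveKernel.kernelOp Q)) :
    (PositiveKernel.IsQuasiCompactOperator (PositiveKernel.kernelOp Q) ∧
      PositiveKernel.essentialSpectralRadius (PositiveKernel.kernelOp Q) ≤
        PositiveKernel.doeblinDelta ν (Q ^ ℓ) ^ (1 / (ℓ : ℝ))) ∧
    ∀ χ : PositiveKernel.BoundedMeasurable (E × E),
      ‖χ‖ₑ * PositiveKernel.doeblinDelta ν (Q ^ ℓ) ^ (1 / (ℓ : ℝ)) <
        spectralRadius ℂ (PositiveKernel.twistedOp Q χ) →
      PositiveKernel.IsQuasiCompactOperator (PositiveKernel.twistedOp Q χ) ∧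
      PositiveKernel.essentialSpectralRadius (PositiveKernel.twistedOp Q χ) ≤
        ‖χ‖ₑ * PositiveKernel.doeblinDelta ν (Q ^ ℓ) ^ (1 / (ℓ : ℝ)) := by
  have hl : ℓ ≠ 0 := Nat.one_le_iff_ne_zero.1 hℓ
  have hν : PositiveKernel.doeblinDelta ν (Q ^ ℓ) ≠ ∞ := by
    intro h
    rw [h, ENNReal.top_rpow_of_pos (by positivity)] at hΔ
    exact not_top_lt hΔ
  have hmain := PositiveKernel.essentialSpectralRadius_twistedOp_le Q hl ν hν
  have hone : PositiveKernel.essentialSpectralRadius (PositiveKernel.kernelOp Q) ≤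
      PositiveKernel.doeblinDelta ν (Q ^ ℓ) ^ (1 / (ℓ : ℝ)) := by
    obtain ⟨χ, hχ, h⟩ := PositiveKernel.kernelOp_eq_twistedOp_one Q
    rw [h]
    refine (hmain χ).trans (mul_le_of_le_one_left' ?_)
    rw [enorm_eq_nnnorm]
    exact_mod_cast hχ
  exact ⟨⟨hone.trans_lt hΔ, hone⟩, fun χ hχ => ⟨(hmain χ).trans_lt hχ, hmain χ⟩⟩
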